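/- Let $\alpha\ge 0$. Consider the triangular lattice with vertices $(x,y,t)$, $x,y\in\mathbb Z$, $t\in\{0,1\}$, placed at $(2x+t,-y)\in\mathbb R^2$. Every vertex is joined to its translates by $(1,0)$, $(0,-1)$ and $(1,-1)$ (horizontal, vertical and diagonal edges). The edges $(x,y,0)(x,y,1)$ have weight $\alpha$, all other edges have weight $1$. Orient the horizontal edges to the right, the vertical edges down if $t=0$ and up if $t=1$, the diagonal edges $(x,y,1)\to(x+1,y+1,0)$ and $(x,y+1,1)\to(x,y,0)$. For $m,n\ge1$ let $K^{(m,n)}$ be the corresponding signed weighted adjacency (Kasteleyn) matrix on the torus of $m\times n$ fundamental domains (cells $\{(x,y,0),(x,y,1)\}$), and let $\langle\cdot\rangle_{m,n}$ be the expectation for the dimer model on this torus, in which a dimer covering has probability proportional to the product of its edge weights; $d_\mu\in\{0,1\}$ is the occupation number of the edge $\mu$. Let $$K_1(w,z)=\begin{pmatrix} z-z^{-1} & \alpha-z-w^{-1}-z^{-1}w^{-1}\\ -\alpha+w+z^{-1}+zw & -(z-z^{-1})\end{pmatrix},\qquad P(w,z)=\det K_1(w,z).$$ 1. For real $k_x,k_y$: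 $P(e^{ik_x},e^{ik_y})=0$ if and only if $\alpha=3$ and $k_x,k_y\in2\pi\mathbb Z$. Now let $\alpha\ne3$. 2. Every $K^{(m,n)}$ is invertible, and for all vertices $u=(x,y,s)$, $v=(x',y',t)$ of the infinite lattice the entries $(K^{(m,n)})^{-1}(u,v)$ (vertices projected to the torus) converge, as $m,n\to\infty$, to $$K^{-1}(u,v)=\int_0^{2\pi}\!\!\int_0^{2\pi}\bigl(K_1(e^{ik_x},e^{ik_y})^{-1}\bigr)_{st}\,e^{-i(k_x(x'-x)+k_y(y'-y))}\,\frac{dk_y}{2\pi}\frac{dk_x}{2\pi}.$$ There are $C,c>0$ (depending only on $\alpha$) with $|K^{-1}(u,v)|\le Ce^{-c\,\mathrm{dist}(u,v)}$ for all $u,v$, where $\mathrm{dist}$ is the Euclidean distance. 3. For all edges $\mu,\nu$ of the infinite lattice the limits $\langle d_\mu\rangle=\lim_{m,n\to\infty}\langle d_\mu\rangle_{m,n}$ and $\langle d_\mu d_\nu\rangle=\lim_{m,n\to\infty}\langle d_\mu d_\nu\rangle_{m,n}$ exist (edges projected to the torus), and there are $C,c>0$ (depending only on $\alpha$) such that for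 all $\mu,\nu$ $$|\langle d_\mu d_\nu\rangle-\langle d_\mu\rangle\langle d_\nu\rangle|\le Ce^{-c\,\mathrm{dist}(\mu,\nu)},$$ where $\mathrm{dist}(\mu,\nu)$ is the Euclidean distance of the midpoints of $\mu$ and $\nu$. -/

import Mathlib

open Filter Topology

noncomputable section

namespace TriDimer

/-- Vertices of the triangular lattice (or of a quotient of it): `(x, y, t)` is the vertex `v_t`
of the translate `w^x z^y` of the fundamental domain `{v_0, v_1}`.  The infinite lattice is
`Vertex ℤ ℤ`; the torus of `m × n` fundamental domains is `Vertex (ZMod m) (ZMod n)`. -/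
abbrev Vertex (A B : Type) : Type := A × B × Fin 2

/-- The three directions of edges: horizontal, vertical, diagonal. -/
inductive Dir : Type
  | hor
  | ver
  | diag
  deriving DecidableEq

instance : Fintype Dir where
  elems := {Dir.hor, Dir.ver, Dir.diag}
  complete d := by cases d <;> simp

/-- Edges: every vertex `v` owns exactly one edge `(v, d)` for each direction `d`,
so there are six edges per fundamental domain. -/
abbrev Edge (A B : Type) : Type := Vertex A B × Dir

/-- First endpoint of an edge. -/
def Edge.src {A B : Type} (e : Edge A B) : Vertex A B := e.1

/-- Second endpoint of an edge.  In the plane, `(x, y, t)` sits at `(2x + t, -y)`, and the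
horizontal, vertical and diagonal edges go by `(1, 0)`, `(0, -1)` and `(1, -1)`. -/
def Edge.tgt {A B : Type} [Add A] [One A] [Add B] [One B] : Edge A B → Vertex A B
  | ((x, y, t), Dir.hor) => if t = 0 then (x, y, 1) else (x + 1, y, 0)
  | ((x, y, t), Dir.ver) => (x, y + 1, t)
  | ((x, y, t), Dir.diag) => if t = 0 then (x, y + 1, 1) else (x + 1, y + 1, 0)

/-- The `2 × 1` periodic edge weights: the horizontal edge inside the fundamental domain has
weight `α`, the five other edges have weight `1`. -/
def Edge.weight {A B : Type} (α : ℝ) : Edge A B → ℝ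
  | ((_, _, t), Dir.hor) => if t = 0 then α else 1
  | (_, Dir.ver) => 1
  | (_, Dir.diag) => 1

/-- Kasteleyn orientation: `1` if the edge is oriented from `src` to `tgt`, `-1` otherwise.
(The vertical edges of the `v_1`-columns and the diagonal edges starting at `v_0` are
oriented from `tgt` to `src`.) -/
def Edge.sign {A B : Type} : Edge A B → ℝ
  | (_, Dir.hor) => 1
  | ((_, _, t), Dir.ver) => if t = 0 then 1 else -1
  | ((_, _, t), Dir.diag) => if t = 0 then -1 else 1

/-! ### The infinite lattice in the plane -/

/-- Position of a vertex of the infinite lattice in the Euclidean plane. -/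
def Vertex.pos (v : Vertex ℤ ℤ) : EuclideanSpace ℝ (Fin 2) :=
  !₂[2 * (v.1 : ℝ) + ((v.2.2 : ℕ) : ℝ), -(v.2.1 : ℝ)]

/-- Euclidean distance of two vertices. -/
def Vertex.distance (u v : Vertex ℤ ℤ) : ℝ := dist (Vertex.pos u) (Vertex.pos v)

/-- Euclidean distance of two edges, measured between their midpoints. -/
def Edge.distance (μ ν : Edge ℤ ℤ) : ℝ :=
  dist (midpoint ℝ (Vertex.pos (Edge.src μ)) (Vertex.pos (Edge.tgt μ)))
    (midpoint ℝ (Vertex.pos (Edge.src ν)) (Vertex.pos (Edge.tgt ν)))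

/-- Projection of a vertex of the infinite lattice to the `m × n` torus. -/
def Vertex.proj (m n : ℕ) (v : Vertex ℤ ℤ) : Vertex (ZMod m) (ZMod n) :=
  ((v.1 : ZMod m), (v.2.1 : ZMod n), v.2.2)

/-- Projection of an edge of the infinite lattice to the `m × n` torus. -/
def Edge.proj (m n : ℕ) (e : Edge ℤ ℤ) : Edge (ZMod m) (ZMod n) :=
  (Vertex.proj m n e.1, e.2)

/-! ### The dimer model on the torus -/

section Torus

variable (m n : ℕ) [NeZero m] [NeZero n]

/-- A dimer covering of the torus: a set of edges in which every vertex has degree one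
(a loop, which only occurs on degenerate tori, would contribute two to the degree). -/
def IsDimerCovering (D : Finset (Edge (ZMod m) (ZMod n))) : Prop :=
  ∀ v : Vertex (ZMod m) (ZMod n),
    (D.filter fun e => Edge.src e = v).card + (D.filter fun e => Edge.tgt e = v).card = 1

open Classical in
/-- The finite set of all dimer coverings of the torus. -/
def coverings : Finset (Finset (Edge (ZMod m) (ZMod n))) :=
  Finset.univ.filter (IsDimerCovering m n)

/-- The partition function: the sum over dimer coverings of the product of the edge weights. -/
def partitionFunction (α : ℝ) : ℝ :=
  ∑ D ∈ coverings m n, ∏ e ∈ D, Edge.weight α e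

/-- Expectation of an observable in the dimer model, in which a covering has probability
proportional to the product of its edge weights. -/
def expectation (α : ℝ) (f : Finset (Edge (ZMod m) (ZMod n)) → ℝ) : ℝ :=
  (∑ D ∈ coverings m n, (∏ e ∈ D, Edge.weight α e) * f D) / partitionFunction m n α

/-- The dimer occupation number `d_e` of the edge `e`, as a function of the covering. -/
def occupation (e : Edge (ZMod m) (ZMod n)) (D : Finset (Edge (ZMod m) (ZMod n))) : ℝ :=
  if e ∈ D then 1 else 0

/-- `⟨d_μ⟩` on the torus. -/
def dimerMean (α : ℝ) (μ : Edge ℤ ℤ) : ℝ :=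
  expectation m n α (occupation m n (Edge.proj m n μ))

/-- `⟨d_μ d_ν⟩` on the torus. -/
def dimerPair (α : ℝ) (μ ν : Edge ℤ ℤ) : ℝ :=
  expectation m n α fun D =>
    occupation m n (Edge.proj m n μ) D * occupation m n (Edge.proj m n ν) D

/-- The (periodic) Kasteleyn matrix of the torus: the weighted adjacency matrix, signed by the
Kasteleyn orientation; parallel edges, which only occur on degenerate tori, are added up. -/
def kasteleyn (α : ℝ) : Matrix (Vertex (ZMod m) (ZMod n)) (Vertex (ZMod m) (ZMod n)) ℝ :=
  fun u v =>
    (∑ e : Edge (ZMod m) (ZMod n),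
      if Edge.src e = u ∧ Edge.tgt e = v then Edge.sign e * Edge.weight α e else 0) -
    ∑ e : Edge (ZMod m) (ZMod n),
      if Edge.src e = v ∧ Edge.tgt e = u then Edge.sign e * Edge.weight α e else 0

end Torus

/-! ### The magnetic Kasteleyn matrix and the infinite periodic limit -/

/-- The magnetic Kasteleyn matrix `K₁(w, z)` of the fundamental domain. -/
def magneticKasteleyn (α : ℝ) (w z : ℂ) : Matrix (Fin 2) (Fin 2) ℂ :=
  !![z - z⁻¹, α - z - w⁻¹ - z⁻¹ * w⁻¹;
    -α + w + z⁻¹ + z * w, -(z - z⁻¹)]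

/-- The characteristic polynomial `P(w, z) = det K₁(w, z)`. -/
def charPoly (α : ℝ) (w z : ℂ) : ℂ := (magneticKasteleyn α w z).det

/-- The inverse Kasteleyn entry `⟨u|K⁻¹|v⟩` in the infinite periodic limit: the Fourier
coefficient of `K₁(e^{i k_x}, e^{i k_y})⁻¹`. -/
def inverseKasteleyn (α : ℝ) (u v : Vertex ℤ ℤ) : ℂ :=
  (1 / (2 * (Real.pi : ℂ)) ^ 2) * ∫ kx in (0 : ℝ)..(2 * Real.pi), ∫ ky in (0 : ℝ)..(2 * Real.pi),
    (magneticKasteleyn α (Complex.exp (kx * Complex.I)) (Complex.exp (ky * Complex.I)))⁻¹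
        u.2.2 v.2.2 *
      Complex.exp (-Complex.I * (kx * ((v.1 - u.1 : ℤ) : ℂ) + ky * ((v.2.1 - u.2.1 : ℤ) : ℂ)))

end TriDimer

end

/-!
On the unit torus the characteristic polynomial is a sum of two squares,
`P(w, z) = |z - z⁻¹|² + |α - z - w⁻¹ - z⁻¹ w⁻¹|²` (`charPoly_eq_normSq`).  The first square leaves
`z = ±1`, and for `α ≥ 0` the second one then leaves only `α = 3`, `w = z = 1`.

*Dimers on a finite torus.*  On a Fock space with one fermionic mode per vertex, the vacuum
amplitude of `∏ₑ (1 + κ_e a_{s(e)} a_{t(e)})` applied to the full state expands into a signed sum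
over dimer coverings (`vac_fullState`).  The canonical anticommutation relations turn creation
operators into the skew matrix `K` of the weights `κ` (`vac_cre`), which gives Wick's formula for
two and four annihilated vertices directly (`vac_two`, `vac_four`), without Pfaffians.

The sign of a covering is a product over pairs of edges.  Each pair sign factors as
`γ(e, f) γ(f, e)`, where `γ(e, f)` is, up to wrapping around the torus, a product over the two
endpoints of `f`.  Since a covering meets each vertex exactly once, `∏_f γ(e, f)` becomes a product
over all vertices of the torus, which is the Kasteleyn sign of `e` (`prod_halfTurn`).  So after
multiplication by the Kasteleyn signs the sign of a covering is `(-1)^(p + q + p q)`, with `p` and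
`q` the numbers of edges that wrap horizontally and vertically (`coverSign_eq`).  Four Kasteleyn
matrices, with periodic or antiperiodic boundary conditions in each direction, combine with
coefficients `±1/2` to remove this sign.  Hence one- and two-dimer expectations are combinations,
with bounded coefficients of sum one, of Wick expressions in the four inverses (`exists_mixture`).

*The limit.*  Plane waves diagonalise the twisted Kasteleyn matrices into blocks `K₁(w, z)` with
`w^m = ±1`, `z^n = ±1`.  These blocks are invertible for `α ≠ 3`, and up to a gauge sign that
cancels in every local observable the inverse entries are Riemann sums of the Fourier integral
(`latticeInverse_eq`, `tendsto_latticeInverse`).  All four boundary conditions have the same limit,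
so the mixture disappears although its individual coefficients need not converge
(`tendsto_mixture`).

*Decay.*  By compactness `K₁⁻¹` is analytic and bounded on a neighbourhood of the unit torus.
Moving one of the two contours to radius `e^{±δ}` gives exponential decay in each coordinate
(`norm_inverseKasteleyn_le`).  In the truncated pair correlation the product of the two means
cancels, and every remaining term contains an inverse entry joining the two edges
(`abs_limitPair_sub_le`).
-/

noncomputable section

namespace TriDimer

/-! ### Fermionic Fock space and the Wick formulas -/

section Fock

variable {V : Type*} [DecidableEq V]

/-- A sign that is antisymmetric off the diagonal, such as the one of a linear order. It fixes the
Jordan-Wigner signs of the fermionic operators. -/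
structure IsOrderSign (σ : V → V → ℝ) : Prop where
  mul_self : ∀ u v, σ u v * σ u v = 1
  antisymm : ∀ u v, u ≠ v → σ v u = -σ u v

/-- The annihilation operator of the mode `v` on the Fock space over `V`. A state is the function of
its coefficients on occupied sets; the coefficient of `ann σ v ψ` at `S` comes from `insert v S`. -/
def ann (σ : V → V → ℝ) (v : V) : Module.End ℝ (Finset V → ℝ) where
  toFun ψ S := if v ∈ S then 0 else (∏ u ∈ S, σ u v) * ψ (insert v S)
  map_add' ψ χ := by
    ext S; simp only [Pi.add_apply]; split_ifs <;> ring
  map_smul' c ψ := by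
    ext S; simp only [Pi.smul_apply, smul_eq_mul, RingHom.id_apply]; split_ifs <;> ring

/-- The creation operator of the mode `v`. -/
def cre (σ : V → V → ℝ) (v : V) : Module.End ℝ (Finset V → ℝ) where
  toFun ψ S := if v ∈ S then (∏ u ∈ S.erase v, σ u v) * ψ (S.erase v) else 0
  map_add' ψ χ := by
    ext S; simp only [Pi.add_apply]; split_ifs <;> ring
  map_smul' c ψ := by
    ext S; simp only [Pi.smul_apply, smul_eq_mul, RingHom.id_apply]; split_ifs <;> ring

/-- The state in which every mode is occupied. -/
def fullState (V : Type*) [Fintype V] [DecidableEq V] : Finset V → ℝ :=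
  Pi.single Finset.univ 1

variable {σ : V → V → ℝ}

theorem ann_apply (v : V) (ψ : Finset V → ℝ) (S : Finset V) :
    ann σ v ψ S = if v ∈ S then 0 else (∏ u ∈ S, σ u v) * ψ (insert v S) := rfl

theorem cre_apply (v : V) (ψ : Finset V → ℝ) (S : Finset V) :
    cre σ v ψ S = if v ∈ S then (∏ u ∈ S.erase v, σ u v) * ψ (S.erase v) else 0 := rfl

theorem cre_fullState [Fintype V] (v : V) : cre σ v (fullState V) = 0 := by
  ext S
  rw [cre_apply]
  split_ifs
  · have : S.erase v ≠ Finset.univ := fun h => by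
      have := Finset.mem_univ v
      rw [← h] at this
      simp at this
    simp [fullState, this]
  · rfl

theorem ann_ann_apply (hσ : IsOrderSign σ) (u v : V) (ψ : Finset V → ℝ) :
    ann σ u (ann σ v ψ) = -ann σ v (ann σ u ψ) := by
  ext S
  simp only [Pi.neg_apply, ann_apply]
  by_cases huv : u = v
  · subst huv; simp
  by_cases hu : u ∈ S
  · simp [hu]
  by_cases hv : v ∈ S
  · simp [hv]
  have h1 : v ∉ insert u S := by simp [hv, Ne.symm huv]
  have h2 : u ∉ insert v S := by simp [hu, huv]
  rw [if_neg hu, if_neg h1, if_neg hv, if_neg h2, Finset.prod_insert hu, Finset.prod_insert hv,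
    hσ.antisymm u v huv, Finset.insert_comm]
  ring

theorem ann_mul_self (u : V) : ann σ u * ann σ u = 0 := by
  refine LinearMap.ext fun ψ => ?_
  ext S
  simp [Module.End.mul_apply, ann_apply]

/-- The canonical anticommutation relation between annihilation and creation operators. -/
theorem ann_mul_cre (hσ : IsOrderSign σ) (i j : V) :
    ann σ j * cre σ i = (if i = j then 1 else 0) - cre σ i * ann σ j := by
  have hsq : ∀ (S : Finset V) (v : V), (∏ u ∈ S, σ u v) * (∏ u ∈ S, σ u v) = 1 := by
    intro S v
    rw [← Finset.prod_mul_distrib]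
    exact Finset.prod_eq_one fun u _ => hσ.mul_self u v
  refine LinearMap.ext fun ψ => ?_
  ext S
  simp only [Module.End.mul_apply, LinearMap.sub_apply, Pi.sub_apply, ann_apply, cre_apply]
  by_cases hij : i = j
  · subst hij
    by_cases hi : i ∈ S
    · have := hsq (S.erase i) i
      simp only [if_pos hi, Finset.notMem_erase, if_false, Finset.insert_erase hi, if_true,
        Module.End.one_apply]
      linear_combination (ψ S) * this
    · have := hsq S i
      simp only [if_neg hi, Finset.mem_insert_self, if_true, Finset.erase_insert hi,
        Module.End.one_apply, sub_zero]
      linear_combination (ψ S) * this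
  · have hji : j ≠ i := Ne.symm hij
    by_cases hi : i ∈ S
    · by_cases hj : j ∈ S
      · simp [hi, hj, hij, hji]
      · have hj' : j ∉ S.erase i := by simp [hj]
        have e1 : (insert j S).erase i = insert j (S.erase i) := by
          rw [Finset.erase_insert_of_ne hji]
        simp only [if_neg hj, if_neg hij, Finset.mem_insert, hi, or_true, if_true, e1,
          if_neg hj', Finset.prod_insert hj', LinearMap.zero_apply, Pi.zero_apply]
        rw [← Finset.mul_prod_erase S _ hi, hσ.antisymm j i hji]
        linear_combination (-(∏ x ∈ S.erase i, σ x j) * (∏ x ∈ S.erase i, σ x i) *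
          ψ (insert j (S.erase i))) * hσ.mul_self j i
    · simp [hi, hij]

theorem commute_ann_pair (hσ : IsOrderSign σ) (a b c : V) :
    Commute (ann σ a * ann σ b) (ann σ c) := by
  refine LinearMap.ext fun ψ => ?_
  simp only [Module.End.mul_apply]
  rw [ann_ann_apply hσ b c, map_neg, ann_ann_apply hσ a c, neg_neg]

theorem ann_pair_mul_self (hσ : IsOrderSign σ) (a b : V) :
    (ann σ a * ann σ b) * (ann σ a * ann σ b) = 0 := by
  rw [← mul_assoc, (commute_ann_pair hσ a b a).eq, ← mul_assoc, ann_mul_self]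
  simp

theorem ann_pair_mul_cre (hσ : IsOrderSign σ) (a b i : V) :
    ann σ a * ann σ b * cre σ i = cre σ i * (ann σ a * ann σ b) +
      ((if i = b then ann σ a else 0) - (if i = a then ann σ b else 0)) := by
  rw [mul_assoc, ann_mul_cre hσ i b, mul_sub, ← mul_assoc, ann_mul_cre hσ i a, sub_mul]
  split_ifs <;> simp [mul_assoc] <;> abel

variable {E : Type*}

/-- The product over the list `L` of `1 + κ_e a_{s(e)} a_{t(e)}`, that is, the exponential of `∑ₑ
κ_e a_{s(e)} a_{t(e)}`: the factors commute and each pair operator squares to zero. -/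
def pairProd (σ : V → V → ℝ) (s t : E → V) (κ : E → ℝ) (L : List E) :
    Module.End ℝ (Finset V → ℝ) :=
  (L.map fun e => 1 + κ e • (ann σ (s e) * ann σ (t e))).prod

variable {s t : E → V}

theorem pairProd_cons (κ : E → ℝ) (e : E) (L : List E) :
    pairProd σ s t κ (e :: L) =
      (1 + κ e • (ann σ (s e) * ann σ (t e))) * pairProd σ s t κ L := by
  simp [pairProd]

theorem commute_pairProd_ann (hσ : IsOrderSign σ) (κ : E → ℝ) (L : List E) (c : V) :
    Commute (pairProd σ s t κ L) (ann σ c) := by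
  apply Commute.list_prod_left
  intro x hx
  obtain ⟨e, -, rfl⟩ := List.mem_map.mp hx
  exact (Commute.one_left _).add_left ((commute_ann_pair hσ _ _ _).smul_left _)

/-- Moving a creation operator to the left through the product of pairs differentiates the exponent:
only the edges at `i` leave an annihilation operator behind. -/
theorem pairProd_mul_cre (hσ : IsOrderSign σ) (κ : E → ℝ) (L : List E) (i : V) :
    pairProd σ s t κ L * cre σ i = cre σ i * pairProd σ s t κ L +
      pairProd σ s t κ L * (L.map fun e => κ e •
        ((if i = t e then ann σ (s e) else 0) - (if i = s e then ann σ (t e) else 0))).sum := by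
  induction L with
  | nil => simp [pairProd]
  | cons e L ih =>
    set X := (if i = t e then ann σ (s e) else 0) - (if i = s e then ann σ (t e) else 0) with hX
    -- The commutator of the pair of `e` with the creation operator involves an endpoint of `e`,
    -- which the pair cannot annihilate a second time.
    have hXP : ann σ (s e) * ann σ (t e) * X = 0 := by
      have h1 : ann σ (s e) * ann σ (t e) * ann σ (s e) = 0 := by
        rw [(commute_ann_pair hσ _ _ _).eq, ← mul_assoc, ann_mul_self, zero_mul]
      have h2 : ann σ (s e) * ann σ (t e) * ann σ (t e) = 0 := by
        rw [mul_assoc, ann_mul_self, mul_zero]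
      rw [hX, mul_sub]
      split_ifs <;> simp [h1, h2]
    have hXc : Commute (pairProd σ s t κ L) X := by
      refine Commute.sub_right ?_ ?_ <;> split_ifs
      all_goals first | exact commute_pairProd_ann hσ κ L _ | exact Commute.zero_right _
    have hpc := ann_pair_mul_cre hσ (s e) (t e) i
    rw [← hX] at hpc
    rw [pairProd_cons, mul_assoc, ih, List.map_cons, List.sum_cons, ← hX]
    set T := pairProd σ s t κ L
    set R := (L.map fun e => κ e •
        ((if i = t e then ann σ (s e) else 0) - (if i = s e then ann σ (t e) else 0))).sum
    set P := ann σ (s e) * ann σ (t e)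
    have h3 : (1 + κ e • P) * T * (κ e • X) = κ e • (X * T) := by
      rw [mul_assoc, mul_smul_comm, hXc.eq, add_mul, one_mul, mul_smul_comm, smul_mul_assoc,
        ← mul_assoc, hXP]
      simp
    rw [mul_add, ← mul_assoc, mul_add _ (κ e • X), h3, add_mul, one_mul, smul_mul_assoc, hpc]
    simp only [smul_add, add_mul, mul_add, one_mul, smul_mul_assoc, mul_smul_comm, mul_assoc]
    abel

section Vacuum

variable [Fintype E]

/-- The vacuum amplitude of the state obtained from `ψ` by the product of pairs over all edges. -/
def vac (σ : V → V → ℝ) (s t : E → V) (κ : E → ℝ) (ψ : Finset V → ℝ) : ℝ :=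
  pairProd σ s t κ Finset.univ.toList ψ ∅

/-- The skew-symmetric matrix of an oriented graph with edges from `s e` to `t e` of weight `κ e`;
parallel edges are added up. -/
def skewMatrix (s t : E → V) (κ : E → ℝ) : Matrix V V ℝ := fun u v =>
  (∑ e : E, if s e = u ∧ t e = v then κ e else 0) - ∑ e : E, if s e = v ∧ t e = u then κ e else 0

theorem vac_smul (κ : E → ℝ) (c : ℝ) (ψ : Finset V → ℝ) :
    vac σ s t κ (c • ψ) = c * vac σ s t κ ψ := by
  simp [vac]

theorem vac_zero (κ : E → ℝ) : vac σ s t κ 0 = 0 := by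
  simp [vac]

theorem vac_sub (κ : E → ℝ) (ψ χ : Finset V → ℝ) :
    vac σ s t κ (ψ - χ) = vac σ s t κ ψ - vac σ s t κ χ := by
  simp [vac]

theorem vac_sum {ι : Type*} (κ : E → ℝ) (I : Finset ι) (ψ : ι → Finset V → ℝ) :
    vac σ s t κ (∑ i ∈ I, ψ i) = ∑ i ∈ I, vac σ s t κ (ψ i) := by
  simp [vac, map_sum]

variable [Fintype V]

/-- Schwinger-Dyson equation: the term with the creation operator moved to the far left has no
vacuum component, since the created mode is occupied, and the commutator leaves the matrix `K`. -/
theorem vac_cre (hσ : IsOrderSign σ) (κ : E → ℝ) (i : V) (ψ : Finset V → ℝ) :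
    vac σ s t κ (cre σ i ψ) = -∑ j, skewMatrix s t κ i j * vac σ s t κ (ann σ j ψ) := by
  have h := congrArg (fun f => f ψ ∅) (pairProd_mul_cre (s := s) (t := t) hσ κ
    Finset.univ.toList i)
  simp only [Module.End.mul_apply, LinearMap.add_apply, Pi.add_apply] at h
  rw [cre_apply, if_neg (Finset.notMem_empty _), zero_add, Finset.sum_map_toList] at h
  change _ = vac σ s t κ _ at h
  change vac σ s t κ _ = _ at h
  rw [h, LinearMap.sum_apply, vac_sum]
  have : ∀ j, skewMatrix s t κ i j * vac σ s t κ (ann σ j ψ) =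
      ∑ e : E, ((if s e = i ∧ t e = j then κ e else 0) -
        (if s e = j ∧ t e = i then κ e else 0)) * vac σ s t κ (ann σ j ψ) := by
    intro j
    rw [skewMatrix, ← Finset.sum_sub_distrib, Finset.sum_mul]
  simp only [this]
  rw [Finset.sum_comm, ← Finset.sum_neg_distrib]
  refine Finset.sum_congr rfl fun e _ => ?_
  simp only [sub_mul, Finset.sum_sub_distrib]
  have e1 : (∑ j, (if s e = i ∧ t e = j then κ e else 0) * vac σ s t κ (ann σ j ψ)) =
      if i = s e then κ e * vac σ s t κ (ann σ (t e) ψ) else 0 := by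
    rw [Finset.sum_eq_single (t e)]
    · by_cases h : s e = i <;> simp [h, eq_comm]
      intro h'; exact absurd h'.symm h
    · intro b _ hb; simp [Ne.symm hb]
    · simp
  have e2 : (∑ j, (if s e = j ∧ t e = i then κ e else 0) * vac σ s t κ (ann σ j ψ)) =
      if i = t e then κ e * vac σ s t κ (ann σ (s e) ψ) else 0 := by
    rw [Finset.sum_eq_single (s e)]
    · by_cases h : t e = i <;> simp [h, eq_comm]
      intro h'; exact absurd h'.symm h
    · intro b _ hb; simp [Ne.symm hb]
    · simp
  rw [e1, e2, LinearMap.smul_apply, vac_smul, LinearMap.sub_apply, vac_sub]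
  split_ifs <;> (try simp only [LinearMap.zero_apply, vac_zero]) <;> ring

theorem vac_ann (hσ : IsOrderSign σ) (κ : E → ℝ) (hK : IsUnit (skewMatrix s t κ).det) (j : V)
    (ψ : Finset V → ℝ) :
    vac σ s t κ (ann σ j ψ) = -∑ i, (skewMatrix s t κ)⁻¹ j i * vac σ s t κ (cre σ i ψ) := by
  have h1 : (skewMatrix s t κ).mulVec (fun j => vac σ s t κ (ann σ j ψ)) =
      -fun i => vac σ s t κ (cre σ i ψ) := by
    ext i
    simp only [Pi.neg_apply]
    rw [vac_cre hσ, neg_neg]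
    rfl
  have h2 := congrArg (fun x => (skewMatrix s t κ)⁻¹.mulVec x) h1
  simp only [Matrix.mulVec_mulVec, Matrix.nonsing_inv_mul _ hK, Matrix.one_mulVec,
    Matrix.mulVec_neg] at h2
  have := congrFun h2 j
  simpa [Matrix.mulVec, dotProduct] using this

omit [Fintype V] in
theorem cre_ann_apply (hσ : IsOrderSign σ) (i j : V) (ψ : Finset V → ℝ) :
    cre σ i (ann σ j ψ) = (if i = j then ψ else 0) - ann σ j (cre σ i ψ) := by
  have h := congrArg (fun f => f ψ) (ann_mul_cre hσ i j)
  simp only [Module.End.mul_apply, LinearMap.sub_apply] at h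
  rw [h]
  split_ifs <;> simp

/-- Wick's formula for two annihilation operators. -/
theorem vac_two (hσ : IsOrderSign σ) (κ : E → ℝ) (hK : IsUnit (skewMatrix s t κ).det) (j p : V) :
    vac σ s t κ (ann σ j (ann σ p (fullState V))) =
      -((skewMatrix s t κ)⁻¹ j p * vac σ s t κ (fullState V)) := by
  rw [vac_ann hσ κ hK, Finset.sum_eq_single p]
  · simp [cre_ann_apply hσ, cre_fullState]
  · intro i _ hi
    simp [cre_ann_apply hσ, cre_fullState, hi, vac_zero]
  · simp

/-- Wick's formula for four annihilation operators. -/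
theorem vac_four (hσ : IsOrderSign σ) (κ : E → ℝ) (hK : IsUnit (skewMatrix s t κ).det)
    (j p q r : V) :
    vac σ s t κ (ann σ j (ann σ p (ann σ q (ann σ r (fullState V))))) =
      ((skewMatrix s t κ)⁻¹ j p * (skewMatrix s t κ)⁻¹ q r -
        (skewMatrix s t κ)⁻¹ j q * (skewMatrix s t κ)⁻¹ p r +
        (skewMatrix s t κ)⁻¹ j r * (skewMatrix s t κ)⁻¹ p q) * vac σ s t κ (fullState V) := by
  have key : ∀ i, vac σ s t κ (cre σ i (ann σ p (ann σ q (ann σ r (fullState V))))) =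
      (if i = p then vac σ s t κ (ann σ q (ann σ r (fullState V))) else 0) -
      (if i = q then vac σ s t κ (ann σ p (ann σ r (fullState V))) else 0) +
      (if i = r then vac σ s t κ (ann σ p (ann σ q (fullState V))) else 0) := by
    intro i
    simp only [cre_ann_apply hσ, cre_fullState, map_sub, map_zero, sub_zero, vac_sub]
    split_ifs <;> (try simp only [map_zero, vac_zero]) <;> ring
  rw [vac_ann hσ κ hK]
  simp only [key, vac_two hσ κ hK, mul_add, mul_sub, mul_ite, mul_zero, Finset.sum_add_distrib,
    Finset.sum_sub_distrib, Finset.sum_ite_eq', Finset.mem_univ, if_true]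
  ring

end Vacuum

end Fock

/-! ### Vacuum amplitudes as signed sums over coverings -/

section Expansion

variable {V E : Type*} [DecidableEq V] [DecidableEq E] {σ : V → V → ℝ} {s t : E → V}

/-- The edges of `D` cover every vertex outside `S` exactly once and avoid `S`. -/
def Covers (s t : E → V) (S : Finset V) (D : Finset E) : Prop :=
  ∀ v, (if v ∈ S then 1 else 0) + (D.filter fun e => s e = v).card +
    (D.filter fun e => t e = v).card = 1

/-- Removing an edge from a covering and adding its endpoints to the occupied set. -/
theorem Covers.mem_iff {S : Finset V} {D : Finset E} {e : E} (he : e ∉ D) :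
    Covers s t S (insert e D) ↔
      s e ∉ S ∧ t e ∉ insert (s e) S ∧ Covers s t (insert (t e) (insert (s e) S)) D := by
  have hs : ∀ v, ((insert e D).filter fun e => s e = v).card =
      (if s e = v then 1 else 0) + (D.filter fun e => s e = v).card := by
    intro v
    rw [Finset.filter_insert]
    split_ifs
    · rw [Finset.card_insert_of_notMem (by simp [he]), add_comm]
    · simp
  have ht : ∀ v, ((insert e D).filter fun e => t e = v).card =
      (if t e = v then 1 else 0) + (D.filter fun e => t e = v).card := by
    intro v
    rw [Finset.filter_insert]
    split_ifs
    · rw [Finset.card_insert_of_notMem (by simp [he]), add_comm]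
    · simp
  have key : ∀ v, s e ∉ S → t e ∉ insert (s e) S →
      (if v ∈ insert (t e) (insert (s e) S) then 1 else 0) =
      (if v ∈ S then 1 else 0) + (if s e = v then 1 else 0) + (if t e = v then 1 else 0) := by
    intro v h1 h2
    simp only [Finset.mem_insert, not_or] at h2 ⊢
    by_cases hv1 : s e = v
    · subst hv1
      simp [h1, h2.1]
    · by_cases hv2 : t e = v
      · subst hv2
        simp [h2.2, hv1]
      · simp [hv1, hv2, Ne.symm hv1, Ne.symm hv2]
  constructor
  · intro h
    have h1 : s e ∉ S := by
      intro hS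
      have := h (s e)
      rw [hs, if_pos hS, if_pos rfl] at this
      omega
    have h2 : t e ∉ insert (s e) S := by
      intro hS
      have := h (t e)
      rw [hs, ht, if_pos rfl] at this
      rcases Finset.mem_insert.mp hS with h' | h'
      · rw [if_pos h'.symm] at this; omega
      · rw [if_pos h'] at this; omega
    refine ⟨h1, h2, fun v => ?_⟩
    have := h v
    rw [hs, ht] at this
    rw [key v h1 h2]
    omega
  · rintro ⟨h1, h2, h⟩ v
    have := h v
    rw [key v h1 h2] at this
    rw [hs, ht]
    omega

omit [DecidableEq E] in
theorem Covers.not_mem {S : Finset V} {D : Finset E} (h : Covers s t S D) {f : E} (hf : f ∈ D) :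
    s f ∉ S ∧ t f ∉ S := by
  constructor
  · intro hS
    have := h (s f)
    have : 0 < (D.filter fun e => s e = s f).card := Finset.card_pos.mpr ⟨f, by simp [hf]⟩
    rw [if_pos hS] at *
    omega
  · intro hS
    have := h (t f)
    have : 0 < (D.filter fun e => t e = t f).card := Finset.card_pos.mpr ⟨f, by simp [hf]⟩
    rw [if_pos hS] at *
    omega

/-- A factorisation `γ e f * γ f e` of the sign for exchanging the pairs of endpoints of two edges
without a common vertex. -/
structure IsHalfCrossing (σ : V → V → ℝ) (s t : E → V) (γ : E → E → ℝ) : Prop where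
  mul_swap : ∀ e f, s e ≠ t e → s f ≠ t f → s e ≠ s f → s e ≠ t f → t e ≠ s f → t e ≠ t f →
    γ e f * γ f e = σ (s e) (s f) * σ (s e) (t f) * σ (t e) (s f) * σ (t e) (t f)

/-- The sign of the covering `D` of the complement of `S`, relative to the half crossing `γ`: the
signs inside the edges, those between `S` and the edges, and those between pairs of edges. -/
def coverSign (σ : V → V → ℝ) (s t : E → V) (γ : E → E → ℝ) (S : Finset V) (D : Finset E) : ℝ :=
  (∏ e ∈ D, (σ (s e) (t e) * ∏ u ∈ S, σ u (s e) * σ u (t e))) * ∏ e ∈ D, ∏ f ∈ D.erase e, γ e f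

theorem coverSign_insert {γ : E → E → ℝ} (hγ : IsHalfCrossing σ s t γ)
    {S : Finset V} {D : Finset E} {e : E} (he : e ∉ D) (hc : Covers s t S (insert e D)) :
    coverSign σ s t γ S (insert e D) =
      (∏ u ∈ S, σ u (s e)) * (∏ u ∈ insert (s e) S, σ u (t e)) *
        coverSign σ s t γ (insert (t e) (insert (s e) S)) D := by
  obtain ⟨h1, h2, h3⟩ := (Covers.mem_iff he).mp hc
  have hse : s e ≠ t e := by
    rintro h; exact h2 (by simp [h])
  unfold coverSign
  have hD : ∏ x ∈ insert e D, ∏ f ∈ (insert e D).erase x, γ x f =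
      (∏ f ∈ D, γ e f * γ f e) * ∏ x ∈ D, ∏ f ∈ D.erase x, γ x f := by
    have h : ∀ x ∈ D, ∏ f ∈ (insert e D).erase x, γ x f = γ x e * ∏ f ∈ D.erase x, γ x f := by
      intro x hx
      have hxe : e ≠ x := fun h => he (h ▸ hx)
      rw [Finset.erase_insert_of_ne hxe, Finset.prod_insert (by simp [he])]
    rw [Finset.prod_insert he, Finset.erase_insert he, Finset.prod_congr rfl h,
      Finset.prod_mul_distrib, Finset.prod_mul_distrib, mul_assoc]
  have hcross : ∏ f ∈ D, γ e f * γ f e =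
      ∏ f ∈ D, σ (s e) (s f) * σ (s e) (t f) * σ (t e) (s f) * σ (t e) (t f) := by
    refine Finset.prod_congr rfl fun f hf => ?_
    obtain ⟨ha, hb⟩ := h3.not_mem hf
    simp only [Finset.mem_insert, not_or] at ha hb
    have hD' : D = insert f (D.erase f) := (Finset.insert_erase hf).symm
    rw [hD'] at h3
    obtain ⟨_, h5, _⟩ := (Covers.mem_iff (Finset.notMem_erase f D)).mp h3
    exact hγ.mul_swap e f hse (fun h => h5 (by simp [h])) (Ne.symm ha.2.1) (Ne.symm hb.2.1)
      (Ne.symm ha.1) (Ne.symm hb.1)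
  rw [hD, hcross, Finset.prod_insert he, Finset.prod_insert h1]
  simp only [Finset.prod_insert h2, Finset.prod_insert h1, Finset.prod_mul_distrib]
  ring

variable [Fintype V]

open Classical in
/-- Expansion of the product of pairs by induction on the list of edges: each new edge is either
left out or used, and in the latter case its endpoints become occupied. -/
theorem pairProd_fullState {γ : E → E → ℝ} (hγ : IsHalfCrossing σ s t γ) (κ : E → ℝ)
    (L : List E) (hL : L.Nodup) (S : Finset V) :
    pairProd σ s t κ L (fullState V) S =
      ∑ D ∈ L.toFinset.powerset.filter (Covers s t S), (∏ e ∈ D, κ e) * coverSign σ s t γ S D := by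
  induction L generalizing S with
  | nil =>
    have : Covers s t S (∅ : Finset E) ↔ S = Finset.univ := by
      constructor
      · intro h
        ext v
        have := h v
        by_contra hv
        simp at hv
        simp [hv] at this
      · rintro rfl v
        simp
    rw [Finset.sum_filter]
    simp [pairProd, fullState, Pi.single_apply, this, coverSign]
  | cons e L ih =>
    rw [List.nodup_cons] at hL
    have heL : e ∉ L.toFinset := by simpa using hL.1
    rw [pairProd_cons, Module.End.mul_apply]
    simp only [LinearMap.add_apply, Module.End.one_apply, LinearMap.smul_apply,
      Module.End.mul_apply, Pi.add_apply, Pi.smul_apply, smul_eq_mul]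
    rw [ann_apply, ann_apply, ih hL.2, ih hL.2, List.toFinset_cons, Finset.sum_filter,
      Finset.sum_filter, Finset.sum_filter, Finset.sum_powerset_insert heL]
    congr 1
    have hmem : ∀ D ∈ L.toFinset.powerset, e ∉ D := fun D hD h =>
      heL (Finset.mem_powerset.mp hD h)
    by_cases h1 : s e ∈ S
    · rw [if_pos h1, mul_zero]
      symm
      refine Finset.sum_eq_zero fun D hD => if_neg fun hc => ?_
      exact ((Covers.mem_iff (hmem D hD)).mp hc).1 h1
    rw [if_neg h1]
    by_cases h2 : t e ∈ insert (s e) S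
    · rw [if_pos h2, mul_zero, mul_zero]
      symm
      refine Finset.sum_eq_zero fun D hD => if_neg fun hc => ?_
      exact ((Covers.mem_iff (hmem D hD)).mp hc).2.1 h2
    rw [if_neg h2, Finset.mul_sum, Finset.mul_sum, Finset.mul_sum]
    refine Finset.sum_congr rfl fun D hD => ?_
    have hiff := Covers.mem_iff (s := s) (t := t) (S := S) (hmem D hD)
    by_cases hc : Covers s t S (insert e D)
    · rw [if_pos hc, if_pos (hiff.mp hc).2.2, coverSign_insert hγ (hmem D hD) hc,
        Finset.prod_insert (hmem D hD)]
      ring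
    · rw [if_neg hc, if_neg fun h => hc (hiff.mpr ⟨h1, h2, h⟩)]
      ring

variable [Fintype E]

open Classical in
theorem vac_fullState {γ : E → E → ℝ} (hγ : IsHalfCrossing σ s t γ) (κ : E → ℝ) :
    vac σ s t κ (fullState V) = ∑ D : Finset E with Covers s t ∅ D,
      (∏ e ∈ D, κ e) * coverSign σ s t γ ∅ D := by
  rw [vac, pairProd_fullState hγ κ _ (Finset.nodup_toList _)]
  simp

omit [Fintype V] [Fintype E] in
/-- Setting the weight of `μ` to zero divides the product of pairs by the factor of `μ`, whose
inverse is `1 - κ_μ a_{s(μ)} a_{t(μ)}`. -/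
theorem pairProd_update_zero (hσ : IsOrderSign σ) (κ : E → ℝ) (μ : E) (L : List E)
    (hL : L.Nodup) (hμ : μ ∈ L) :
    pairProd σ s t (Function.update κ μ 0) L =
      pairProd σ s t κ L * (1 - κ μ • (ann σ (s μ) * ann σ (t μ))) := by
  induction L with
  | nil => simp at hμ
  | cons e L ih =>
    rw [List.nodup_cons] at hL
    rw [pairProd_cons, pairProd_cons]
    by_cases h : e = μ
    · subst h
      have hc : Commute (pairProd σ s t κ L) (ann σ (s e) * ann σ (t e)) :=
        (commute_pairProd_ann hσ κ L _).mul_right (commute_pairProd_ann hσ κ L _)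
      have h0 := ann_pair_mul_self hσ (s e) (t e)
      have hL' : pairProd σ s t (Function.update κ e 0) L = pairProd σ s t κ L := by
        unfold pairProd
        congr 1
        refine List.map_congr_left fun f hf => ?_
        rw [Function.update_of_ne]
        rintro rfl
        exact hL.1 hf
      rw [hL', Function.update_self, zero_smul, add_zero, one_mul]
      set P := ann σ (s e) * ann σ (t e)
      set T := pairProd σ s t κ L
      have hc' : Commute T (1 - κ e • P) :=
        (Commute.one_right _).sub_right (hc.smul_right _)
      -- The pair operator squares to zero.
      have h4 : (1 + κ e • P) * (1 - κ e • P) = 1 := by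
        rw [mul_sub, mul_one, add_mul, one_mul, mul_smul_comm, smul_mul_assoc, h0]
        simp
      rw [mul_assoc, hc'.eq, ← mul_assoc, h4, one_mul]
    · have hμ' : μ ∈ L := by
        rcases List.mem_cons.mp hμ with h' | h'
        · exact absurd h'.symm h
        · exact h'
      rw [ih hL.2 hμ', Function.update_of_ne h, mul_assoc]

omit [Fintype V] in
theorem vac_update_zero (hσ : IsOrderSign σ) (κ : E → ℝ) (μ : E) (ψ : Finset V → ℝ) :
    vac σ s t (Function.update κ μ 0) ψ =
      vac σ s t κ ψ - κ μ * vac σ s t κ (ann σ (s μ) (ann σ (t μ) ψ)) := by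
  rw [vac, pairProd_update_zero hσ κ μ _ (Finset.nodup_toList _) (by simp)]
  simp [vac, Module.End.mul_apply]

omit [Fintype E] in
theorem prod_update_zero (κ : E → ℝ) (μ : E) (D : Finset E) :
    ∏ e ∈ D, Function.update κ μ 0 e = if μ ∈ D then 0 else ∏ e ∈ D, κ e := by
  split_ifs with h
  · exact Finset.prod_eq_zero h (by simp)
  · exact Finset.prod_congr rfl fun e he => Function.update_of_ne (fun h' => h (by rwa [← h'])) _ _

open Classical in
/-- Annihilating the endpoints of `μ` restricts the sum over coverings to those that use `μ`. -/
theorem vac_pair {γ : E → E → ℝ} (hσ : IsOrderSign σ) (hγ : IsHalfCrossing σ s t γ)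
    (κ : E → ℝ) (μ : E) :
    κ μ * vac σ s t κ (ann σ (s μ) (ann σ (t μ) (fullState V))) =
      ∑ D : Finset E with Covers s t ∅ D,
        (∏ e ∈ D, κ e) * coverSign σ s t γ ∅ D * (if μ ∈ D then 1 else 0) := by
  have h1 := vac_update_zero (s := s) (t := t) hσ κ μ (fullState V)
  rw [vac_fullState hγ, vac_fullState hγ] at h1
  have hsub : ∀ A B C : ℝ, A = B - C → C = B - A := fun A B C h => by rw [h]; ring
  rw [hsub _ _ _ h1, ← Finset.sum_sub_distrib]
  refine Finset.sum_congr rfl fun D _ => ?_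
  rw [prod_update_zero]
  split_ifs <;> ring

open Classical in
theorem vac_pair_pair {γ : E → E → ℝ} (hσ : IsOrderSign σ) (hγ : IsHalfCrossing σ s t γ)
    (κ : E → ℝ) (μ ν : E) (hμν : μ ≠ ν) :
    κ μ * κ ν * vac σ s t κ (ann σ (s μ) (ann σ (t μ) (ann σ (s ν) (ann σ (t ν) (fullState V))))) =
      ∑ D : Finset E with Covers s t ∅ D,
        (∏ e ∈ D, κ e) * coverSign σ s t γ ∅ D *
          ((if μ ∈ D then 1 else 0) * (if ν ∈ D then 1 else 0)) := by
  have h1 := vac_update_zero (s := s) (t := t) hσ κ μ (ann σ (s ν) (ann σ (t ν) (fullState V)))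
  have h2 := vac_pair hσ hγ κ ν
  have h3 := vac_pair hσ hγ (Function.update κ μ 0) ν
  rw [Function.update_of_ne hμν.symm, h1, mul_sub, h2] at h3
  have hsub : ∀ A B C : ℝ, B - κ ν * (κ μ * C) = A → κ μ * κ ν * C = B - A :=
    fun A B C h => by rw [← h]; ring
  rw [hsub _ _ _ h3, ← Finset.sum_sub_distrib]
  refine Finset.sum_congr rfl fun D _ => ?_
  rw [prod_update_zero]
  split_ifs <;> ring

end Expansion

/-! ### Parity of the crossings of two edges of a torus -/

section Crossing

open Classical in
/-- The Iverson bracket. -/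
def iv (P : Prop) : ℕ := if P then 1 else 0

theorem iv_false : iv False = 0 := by simp [iv]

theorem iv_true : iv True = 1 := by simp [iv]

/-- An edge of a torus cut open to a grid of `L` columns and `n` rows: it leads from column `c`, row
`r` to column `c'`, row `r'`. The proposition `dy` says that it leads to the next row, `X` and `Y`
that it wraps around horizontally and vertically. -/
structure Link (L n c r c' r' : ℕ) (dy X Y : Prop) : Prop where
  col : (¬X ∧ (c' = c ∨ c' = c + 1)) ∨ (X ∧ c + 1 = L ∧ c' = 0)
  row : (¬dy ∧ r' = r ∧ ¬Y ∧ (X ∨ c' = c + 1)) ∨ (dy ∧ r' = r + 1 ∧ ¬Y) ∨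
    (dy ∧ Y ∧ r + 1 = n ∧ r' = 0)
  col_lt : c < L
  row_lt : r < n

variable {L n c r c' r' d s d' s' : ℕ} {dy X Y dyf Xf Yf : Prop}

/-- Exactly one endpoint lies in a row before `y` if the edge either enters row `y` or wraps
vertically. -/
theorem Link.row_parity (h : Link L n c r c' r' dy X Y) {y : ℕ} (hy : y < n) :
    (iv (r < y) + iv (r' < y) + iv (dy ∧ y = r') + iv Y) % 2 = 0 := by
  rcases h.row with ⟨h1, h2, h3, -⟩ | ⟨h1, h2, h3⟩ | ⟨h1, h3, h5, h2⟩ <;>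
    simp only [h1, h2, h3, true_and, false_and, iv_true, iv_false] <;>
    unfold iv <;> split_ifs <;> omega

/-- Exactly one endpoint lies in a row after `y` if the edge either leaves row `y` or wraps
vertically. The parity is needed only in the case `Z`. -/
theorem Link.above_parity (h : Link L n c r c' r' dy X Y) {y : ℕ} (hy : y < n) (Z : Prop) :
    (iv (Z ∧ y < r) + iv (Z ∧ y < r') + iv (Z ∧ dy ∧ r = y) + iv (Z ∧ Y)) % 2 = 0 := by
  by_cases hZ : Z
  swap
  · simp [hZ, iv_false]
  rcases h.row with ⟨h1, h2, h3, -⟩ | ⟨h1, h2, h3⟩ | ⟨h1, h3, h5, h2⟩ <;>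
    simp only [hZ, h1, h2, h3, true_and, false_and, iv_true, iv_false] <;>
    unfold iv <;> split_ifs <;> omega

theorem Link.hor (h : Link L n c r c' r' False X Y) : r' = r ∧ ¬Y := by
  have := h.row
  simp only [not_false_iff, true_and, false_and, or_false] at this
  exact ⟨this.1, this.2.1⟩

theorem iv_trichotomy (Z : Prop) {y r' c' d : ℕ} (h : ¬(y = r' ∧ d = c')) :
    (iv (Z ∧ y = r') + iv (Z ∧ y = r' ∧ d < c') + iv (Z ∧ r' = y ∧ c' < d)) % 2 = 0 := by
  unfold iv
  by_cases hZ : Z <;> simp only [hZ, true_and, false_and, if_false]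
  split_ifs <;> omega

/-- Column `d` separates the endpoints of a horizontal edge in row `y` exactly if the edge wraps. -/
theorem Link.hor_parity (h : Link L n c r c' r' False X Y) {y d : ℕ} (hd : d < L)
    (h2 : ¬(y = r' ∧ d = c')) :
    (iv (r = y ∧ c < d) + iv (r' = y ∧ c' < d) + iv (X ∧ r = y)) % 2 = 0 := by
  obtain ⟨h3, h4, h5, h6⟩ := h
  unfold iv
  by_cases hX : X <;> simp [hX] at h3 h4 ⊢
  all_goals split_ifs <;> omega

/-- The crossing parity of two disjoint edges. The first eight terms compare the endpoints of the
two edges in the lexicographic order of rows and columns; the others are the exponents of the two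
half crossings. -/
theorem Link.crossing_parity (h : Link L n c r c' r' dy X Y) (hf : Link L n d s d' s' dyf Xf Yf)
    (h1 : ¬(r = s ∧ c = d)) (h2 : ¬(r = s' ∧ c = d')) (h3 : ¬(r' = s ∧ c' = d))
    (h4 : ¬(r' = s' ∧ c' = d')) (hc' : c' < L) (hr' : r' < n) (hd' : d' < L) (hs' : s' < n) :
    (iv (r < s) + iv (r = s ∧ c < d) + iv (r < s') + iv (r = s' ∧ c < d') +
      iv (r' < s) + iv (r' = s ∧ c' < d) + iv (r' < s') + iv (r' = s' ∧ c' < d') +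
      iv (dy ∧ s = r' ∧ d < c') + iv (dy ∧ s' = r' ∧ d' < c') +
      iv (dyf ∧ r = s' ∧ c < d') + iv (dyf ∧ r' = s' ∧ c' < d') +
      iv (X ∧ r < s) + iv (X ∧ r < s') + iv (Xf ∧ s < r) + iv (Xf ∧ s < r') +
      iv (X ∧ Yf) + iv (Xf ∧ Y)) % 2 = 0 := by
  have hc := h.col_lt; have hr := h.row_lt; have hd := hf.col_lt; have hs := hf.row_lt
  have a1 := h.row_parity hs
  have a2 := h.row_parity hs'
  have b1 := hf.above_parity hr X
  have b2 := h.above_parity hs Xf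
  have t1 := iv_trichotomy dy (y := s) (r' := r') (c' := c') (d := d) (by omega)
  have t2 := iv_trichotomy dy (y := s') (r' := r') (c' := c') (d := d') (by omega)
  by_cases hdy : dy
  · by_cases hdf : dyf
    · simp only [hdy, hdf, true_and] at *
      -- Both edges lead to the next row, so they share the first row exactly if they share the
      -- second.
      have hrow : r' = s' ↔ r = s := by
        have := h.row; have := hf.row; simp only [not_true, false_and, true_and, false_or] at *
        omega
      have hk : (iv (r = s ∧ c < d) + iv (r' = s' ∧ c' < d') + iv (X ∧ s = r) +
          iv (Xf ∧ r = s)) % 2 = 0 := by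
        by_cases hrs : r = s
        · have h5 := h.col; have h6 := hf.col
          have h7 := hrow.mpr hrs
          simp only [iv, hrs, h7, true_and, and_true]
          by_cases hX : X <;> by_cases hXf : Xf <;>
            simp only [hX, hXf, not_true, not_false_iff, true_and, false_and, false_or, or_false,
              if_false] at h5 h6 ⊢ <;>
            split_ifs <;> omega
        · simp [iv, hrs, hrow, Ne.symm hrs]
      omega
    · simp only [hdy, hdf, true_and, false_and, and_false] at *
      have e1 := hf.hor_parity (y := r) (d := c) hc h2
      have t3 := iv_trichotomy True (y := r) (r' := s) (c' := d) (d := c) (by omega)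
      have t4 := iv_trichotomy True (y := r) (r' := s') (c' := d') (d := c) (by omega)
      obtain ⟨rfl, hY⟩ := hf.hor
      rw [eq_comm (a := r)] at b2
      simp only [true_and, iv_false, hY, and_false] at *
      omega
  · by_cases hdf : dyf
    · simp only [hdy, hdf, true_and, false_and, and_false] at *
      obtain ⟨rfl, hY⟩ := h.hor
      have e1 := h.hor_parity (y := s) (d := d) hd (by omega)
      rw [eq_comm (a := s)] at b1
      simp only [iv_false, hY, and_false] at *
      omega
    · simp only [hdy, hdf, false_and, and_false] at *
      obtain ⟨rfl, hY⟩ := h.hor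
      obtain ⟨rfl, hYf⟩ := hf.hor
      have e1 := h.hor_parity (y := s') (d := d) hd (by omega)
      have e2 := h.hor_parity (y := s') (d := d') hd' (by omega)
      simp only [iv_false, hY, hYf, and_false] at *
      omega

end Crossing

/-! ### The sign of a dimer covering of the torus -/

section TorusSigns

variable {m n : ℕ} [NeZero m] [NeZero n]

/-- The column of a vertex, between `0` and `2 m - 1`. -/
def col (v : Vertex (ZMod m) (ZMod n)) : ℕ := 2 * v.1.val + (v.2.2 : ℕ)

/-- The row of a vertex. -/
def row (v : Vertex (ZMod m) (ZMod n)) : ℕ := v.2.1.val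

/-- The edge crosses the boundary between the last and the first column. -/
def wrapX (e : Edge (ZMod m) (ZMod n)) : Prop :=
  e.2 ≠ Dir.ver ∧ e.1.2.2 = 1 ∧ e.1.1.val + 1 = m

/-- The edge crosses the boundary between the last and the first row. -/
def wrapY (e : Edge (ZMod m) (ZMod n)) : Prop :=
  e.2 ≠ Dir.hor ∧ e.1.2.1.val + 1 = n

theorem val_add_one_cases {k : ℕ} [NeZero k] (x : ZMod k) :
    (x.val + 1 = k ∧ (x + 1).val = 0) ∨ (x.val + 1 < k ∧ (x + 1).val = x.val + 1) := by
  have hx := ZMod.val_lt x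
  have h : (x + 1).val = (x.val + 1) % k := by
    conv_lhs => rw [← ZMod.natCast_zmod_val x]
    rw [← Nat.cast_one, ← Nat.cast_add, ZMod.val_natCast]
  rcases Nat.lt_or_ge (x.val + 1) k with h1 | h1
  · right
    exact ⟨h1, by rw [h, Nat.mod_eq_of_lt h1]⟩
  · left
    have h2 : x.val + 1 = k := by omega
    exact ⟨h2, by rw [h, h2, Nat.mod_self]⟩

theorem link (e : Edge (ZMod m) (ZMod n)) :
    Link (2 * m) n (col (Edge.src e)) (row (Edge.src e)) (col (Edge.tgt e)) (row (Edge.tgt e))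
      (e.2 ≠ Dir.hor) (wrapX e) (wrapY e) := by
  obtain ⟨⟨x, y, t⟩, d⟩ := e
  have hx := ZMod.val_lt x
  have hy := ZMod.val_lt y
  have hx1 := val_add_one_cases x
  have hy1 := val_add_one_cases y
  refine ⟨?_, ?_, ?_, ?_⟩ <;> fin_cases t <;> cases d <;>
    simp [Edge.src, Edge.tgt, col, row, wrapX, wrapY, -ZMod.val_eq_zero] <;> omega

omit [NeZero n] in
theorem col_lt (v : Vertex (ZMod m) (ZMod n)) : col v < 2 * m := by
  have := ZMod.val_lt v.1
  have := v.2.2.isLt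
  unfold col
  omega

omit [NeZero m] in
theorem row_lt (v : Vertex (ZMod m) (ZMod n)) : row v < n := ZMod.val_lt v.2.1

theorem eq_of_row_col {u v : Vertex (ZMod m) (ZMod n)} (h1 : row u = row v) (h2 : col u = col v) :
    u = v := by
  obtain ⟨x, y, t⟩ := u
  obtain ⟨x', y', t'⟩ := v
  simp only [row, col] at h1 h2
  have ht := t.isLt
  have ht' := t'.isLt
  have h3 : x.val = x'.val := by omega
  have h4 : (t : ℕ) = t' := by omega
  rw [ZMod.val_injective m h3, ZMod.val_injective n h1, Fin.ext h4]

/-- `1` if `u` precedes `v` in the lexicographic order of rows and columns, and `-1` otherwise. -/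
def orderSign (u v : Vertex (ZMod m) (ZMod n)) : ℝ :=
  -(-1) ^ (iv (row u < row v) + iv (row u = row v ∧ col u < col v))

theorem neg_one_pow_eq_of_even {a b : ℕ} (h : (a + b) % 2 = 0) : (-1 : ℝ) ^ a = (-1) ^ b := by
  rw [neg_one_pow_eq_pow_mod_two, neg_one_pow_eq_pow_mod_two (n := b)]
  congr 1
  omega

theorem isOrderSign : IsOrderSign (orderSign (m := m) (n := n)) where
  mul_self u v := by
    unfold orderSign
    rw [neg_mul_neg, ← pow_add, ← two_mul, pow_mul]
    norm_num
  antisymm u v huv := by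
    unfold orderSign
    rw [neg_neg]
    have h : ∀ a b : ℕ, (a + b) % 2 = 1 → -(-1 : ℝ) ^ a = (-1) ^ b := by
      intro a b hab
      have := neg_one_pow_eq_of_even (a := a + 1) (b := b) (by omega)
      rw [← this, pow_succ]
      ring
    apply h
    have h1 : ¬(row u = row v ∧ col u = col v) := fun h => huv (eq_of_row_col h.1 h.2)
    unfold iv
    split_ifs <;> omega

/-- The exponent with which the vertex `v` enters the half crossings of the edge `e`: it counts `v`
if `e` is not horizontal and `v` lies left of its target in the target row, and again if `e` wraps
horizontally and `v` lies in a later row than the source. -/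
def halfTurn (e : Edge (ZMod m) (ZMod n)) (v : Vertex (ZMod m) (ZMod n)) : ℕ :=
  iv (e.2 ≠ Dir.hor ∧ row v = row (Edge.tgt e) ∧ col v < col (Edge.tgt e)) +
    iv (wrapX e ∧ row (Edge.src e) < row v)

/-- The half crossing of `e` with `f`: a product over the two endpoints of `f`, corrected by a sign
if `e` wraps horizontally and `f` vertically. -/
def halfCrossing (e f : Edge (ZMod m) (ZMod n)) : ℝ :=
  (-1) ^ halfTurn e (Edge.src f) * (-1) ^ halfTurn e (Edge.tgt f) * (-1) ^ iv (wrapX e ∧ wrapY f)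

theorem isHalfCrossing :
    IsHalfCrossing (orderSign (m := m) (n := n)) Edge.src Edge.tgt halfCrossing where
  mul_swap e f he hf h1 h2 h3 h4 := by
    have hne : ∀ {u v : Vertex (ZMod m) (ZMod n)}, u ≠ v → ¬(row u = row v ∧ col u = col v) :=
      fun huv h => huv (eq_of_row_col h.1 h.2)
    have key := (link e).crossing_parity (link f) (hne h1) (hne h2) (hne h3) (hne h4)
      (col_lt _) (row_lt _) (col_lt _) (row_lt _)
    simp only [halfCrossing, orderSign, halfTurn, neg_mul, mul_neg, neg_neg, ← pow_add]
    apply neg_one_pow_eq_of_even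
    rw [← key]
    congr 1
    ring

variable (m n) in
omit [NeZero m] [NeZero n] in
theorem covers_iff (D : Finset (Edge (ZMod m) (ZMod n))) :
    Covers Edge.src Edge.tgt ∅ D ↔ IsDimerCovering m n D := by
  simp [Covers, IsDimerCovering]

/-- A covering meets every vertex exactly once. -/
theorem prod_endpoints {D : Finset (Edge (ZMod m) (ZMod n))} (hD : IsDimerCovering m n D)
    (h : Vertex (ZMod m) (ZMod n) → ℝ) :
    ∏ f ∈ D, h (Edge.src f) * h (Edge.tgt f) = ∏ v, h v := by
  have h1 : ∀ g : Edge (ZMod m) (ZMod n) → Vertex (ZMod m) (ZMod n),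
      ∏ f ∈ D, h (g f) = ∏ v, h v ^ (D.filter fun e => g e = v).card := by
    intro g
    rw [← Finset.prod_fiberwise D g]
    refine Finset.prod_congr rfl fun v _ => ?_
    rw [Finset.prod_congr rfl (g := fun _ => h v), Finset.prod_const]
    intro e he
    rw [(Finset.mem_filter.mp he).2]
  rw [Finset.prod_mul_distrib, h1, h1, ← Finset.prod_mul_distrib]
  refine Finset.prod_congr rfl fun v _ => ?_
  rw [← pow_add, hD v, pow_one]

/-- The product of the half-crossing signs of `e` over all vertices is its Kasteleyn sign. A
complete row has an even number `2 m` of vertices, so it does not count; left of the target of a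
non-horizontal edge, the number of vertices has the parity of the column of the target. -/
theorem prod_halfTurn (e : Edge (ZMod m) (ZMod n)) :
    ∏ v, (-1 : ℝ) ^ halfTurn e v = Edge.sign e := by
  have h0 : Edge.sign e = (-1) ^ (iv (e.2 ≠ Dir.hor) * ((Edge.tgt e).2.2 : ℕ)) := by
    obtain ⟨⟨x, y, t⟩, d⟩ := e
    fin_cases t <;> cases d <;> simp [Edge.sign, Edge.tgt, iv]
  rw [h0]
  simp only [Fintype.prod_prod_type, Fin.prod_univ_two, ← pow_add]
  set u := Edge.tgt e with hu
  obtain ⟨x', y', t'⟩ := u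
  rw [Finset.prod_eq_single x', Finset.prod_eq_single y']
  · apply neg_one_pow_eq_of_even
    simp only [halfTurn, ← hu, row, col]
    have := t'.isLt
    unfold iv
    split_ifs <;> simp_all <;> omega
  · intro y _ hy
    have hy' : y.val ≠ y'.val := fun h => hy (ZMod.val_injective n h)
    rw [← pow_zero (-1 : ℝ)]
    apply neg_one_pow_eq_of_even
    simp only [halfTurn, ← hu, row, col, hy', false_and, and_false, iv_false]
    omega
  · simp
  · intro x _ hx
    refine Finset.prod_eq_one fun y _ => ?_
    have hx' : x.val ≠ x'.val := fun h => hx (ZMod.val_injective m h)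
    rw [← pow_zero (-1 : ℝ)]
    apply neg_one_pow_eq_of_even
    simp only [halfTurn, ← hu, row, col]
    have hlt : ∀ t : ℕ, t < 2 → (2 * x.val + t < 2 * x'.val + t' ↔ x.val < x'.val) := by
      intro t ht
      have := t'.isLt
      omega
    rw [Fin.val_zero, Fin.val_one, hlt 0 (by norm_num), hlt 1 (by norm_num)]
    omega
  · simp

theorem neg_one_pow_mul_self (k : ℕ) : (-1 : ℝ) ^ k * (-1) ^ k = 1 := by
  rw [← pow_add, ← two_mul, pow_mul]; norm_num

theorem prod_halfCrossing {D : Finset (Edge (ZMod m) (ZMod n))} (hn : 2 ≤ n)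
    (hD : IsDimerCovering m n D)
    {e : Edge (ZMod m) (ZMod n)} (he : e ∈ D) :
    Edge.sign e * orderSign (Edge.src e) (Edge.tgt e) * ∏ f ∈ D.erase e, halfCrossing e f =
      (-1) ^ (iv (wrapX e) + iv (wrapY e) + iv (wrapX e) * ∑ f ∈ D, iv (wrapY f)) := by
  have hs : Edge.sign e * Edge.sign e = 1 := by
    obtain ⟨⟨x, y, t⟩, d⟩ := e
    fin_cases t <;> cases d <;> simp [Edge.sign]
  have hcc : halfCrossing e e * halfCrossing e e = 1 := by
    rw [halfCrossing, ← pow_add, ← pow_add]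
    exact neg_one_pow_mul_self _
  -- Including `f = e` makes the endpoints of the `f` run through all vertices.
  have h1 : ∏ f ∈ D.erase e, halfCrossing e f = halfCrossing e e * ∏ f ∈ D, halfCrossing e f := by
    rw [← Finset.mul_prod_erase D _ he, ← mul_assoc, hcc, one_mul]
  have h2 : ∏ f ∈ D, halfCrossing e f =
      Edge.sign e * (-1) ^ (iv (wrapX e) * ∑ f ∈ D, iv (wrapY f)) := by
    unfold halfCrossing
    rw [Finset.prod_mul_distrib, prod_endpoints hD (fun v => (-1 : ℝ) ^ halfTurn e v),
      prod_halfTurn, Finset.prod_pow_eq_pow_sum, Finset.mul_sum]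
    congr 2
    refine Finset.sum_congr rfl fun f _ => ?_
    by_cases hX : wrapX e <;> by_cases hY : wrapY f <;> simp [hX, hY, iv]
  rw [h1, h2, pow_add]
  -- The half crossing of an edge with itself is its order sign, up to wrapping.
  have h3 : orderSign (Edge.src e) (Edge.tgt e) * halfCrossing e e =
      (-1) ^ (iv (wrapX e) + iv (wrapY e)) := by
    unfold orderSign halfCrossing halfTurn
    rw [neg_mul, ← pow_add, ← pow_add, ← pow_add, neg_eq_neg_one_mul, ← pow_succ']
    apply neg_one_pow_eq_of_even
    have hl := link e
    have hc := col_lt (Edge.tgt e)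
    rcases hl.row with ⟨h1, h2, h3, h4⟩ | ⟨h1, h2, h3⟩ | ⟨h1, h3, h5, h2⟩
    · by_cases hX : wrapX e
      · have := hl.col
        simp only [hX, not_true, false_and, true_and, false_or] at this
        simp only [h1, h2, h3, hX, true_and, false_and, and_false, iv_true, iv_false]
        unfold iv
        split_ifs <;> omega
      · have := h4.resolve_left hX
        simp only [h1, h2, h3, hX, true_and, false_and, and_false, iv_false, this]
        unfold iv
        split_ifs <;> omega
    · by_cases hX : wrapX e <;>
        simp only [ne_eq, h1, h2, h3, hX, true_and, false_and, iv_true, iv_false] <;>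
        unfold iv <;> split_ifs <;> omega
    · by_cases hX : wrapX e <;>
        simp only [ne_eq, h1, h2, h3, hX, true_and, false_and, iv_true, iv_false] <;>
        unfold iv <;> split_ifs <;> omega
  rw [← h3]
  linear_combination (orderSign e.src e.tgt * halfCrossing e e *
    (-1) ^ (iv (wrapX e) * ∑ f ∈ D, iv (wrapY f))) * hs

/-- After multiplication by its Kasteleyn signs, the sign of a covering depends only on how often it
wraps around the torus. The assumption `2 ≤ n` separates the rows of the endpoints of an edge that
wraps vertically. -/
theorem coverSign_eq {D : Finset (Edge (ZMod m) (ZMod n))} (hn : 2 ≤ n)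
    (hD : IsDimerCovering m n D) :
    (∏ e ∈ D, Edge.sign e) * coverSign orderSign Edge.src Edge.tgt halfCrossing ∅ D =
      (-1) ^ ((∑ e ∈ D, iv (wrapX e)) + (∑ e ∈ D, iv (wrapY e)) +
        (∑ e ∈ D, iv (wrapX e)) * ∑ e ∈ D, iv (wrapY e)) := by
  unfold coverSign
  simp only [Finset.prod_empty, mul_one]
  rw [← mul_assoc, ← Finset.prod_mul_distrib, ← Finset.prod_mul_distrib,
    Finset.prod_congr rfl fun e he => prod_halfCrossing hn hD he, Finset.prod_pow_eq_pow_sum]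
  rw [Finset.sum_add_distrib, Finset.sum_add_distrib, Finset.sum_mul]

end TorusSigns

/-! ### The four twisted Kasteleyn matrices and the dimer correlations -/

section Mixture

variable {m n : ℕ} [NeZero m] [NeZero n]

/-- The sign picked up at a boundary, which is antiperiodic if `b` holds. -/
def twistSign (b : Bool) : ℝ := if b then -1 else 1

theorem twistSign_mul_self (b : Bool) : twistSign b * twistSign b = 1 := by
  cases b <;> simp [twistSign]

/-- The coefficients of the four boundary conditions in the dimer partition function. -/
def twistCoeff (b : Bool × Bool) : ℝ := if b = (false, false) then -1 / 2 else 1 / 2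

/-- The Kasteleyn sign with the boundary conditions `b`. -/
def twistedSign (b : Bool × Bool) (e : Edge (ZMod m) (ZMod n)) : ℝ :=
  twistSign b.1 ^ iv (wrapX e) * twistSign b.2 ^ iv (wrapY e) * Edge.sign e

/-- The signed edge weight with the boundary conditions `b`. -/
def twistedWeight (α : ℝ) (b : Bool × Bool) (e : Edge (ZMod m) (ZMod n)) : ℝ :=
  twistedSign b e * Edge.weight α e

variable (m n) in
/-- The Kasteleyn matrix with the boundary conditions `b`. -/
def twistedKasteleyn (α : ℝ) (b : Bool × Bool) :
    Matrix (Vertex (ZMod m) (ZMod n)) (Vertex (ZMod m) (ZMod n)) ℝ :=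
  skewMatrix Edge.src Edge.tgt (twistedWeight α b)

theorem twistedKasteleyn_false (α : ℝ) :
    twistedKasteleyn m n α (false, false) = kasteleyn m n α := by
  have : twistedWeight (m := m) (n := n) α (false, false) =
      fun e => Edge.sign e * Edge.weight α e := by
    ext e
    simp [twistedWeight, twistedSign, twistSign]
  rw [twistedKasteleyn, this]
  rfl

theorem weight_nonneg {A B : Type} {α : ℝ} (hα : 0 ≤ α) (e : Edge A B) : 0 ≤ Edge.weight α e := by
  obtain ⟨⟨x, y, t⟩, d⟩ := e
  cases d <;> simp only [Edge.weight]
  · split_ifs <;> positivity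
  · positivity
  · positivity

theorem twisted_coverSign {D : Finset (Edge (ZMod m) (ZMod n))} (hn : 2 ≤ n)
    (hD : IsDimerCovering m n D) (b : Bool × Bool) :
    (∏ e ∈ D, twistedSign b e) * coverSign orderSign Edge.src Edge.tgt halfCrossing ∅ D =
      twistSign b.1 ^ (∑ e ∈ D, iv (wrapX e)) * twistSign b.2 ^ (∑ e ∈ D, iv (wrapY e)) *
      (-1) ^ ((∑ e ∈ D, iv (wrapX e)) + (∑ e ∈ D, iv (wrapY e)) +
        (∑ e ∈ D, iv (wrapX e)) * ∑ e ∈ D, iv (wrapY e)) := by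
  unfold twistedSign
  rw [Finset.prod_mul_distrib, Finset.prod_mul_distrib, mul_assoc, coverSign_eq hn hD,
    Finset.prod_pow_eq_pow_sum, Finset.prod_pow_eq_pow_sum]

/-- The four boundary conditions together give every covering the sign `+1`. -/
theorem sum_twistCoeff {D : Finset (Edge (ZMod m) (ZMod n))} (hn : 2 ≤ n)
    (hD : IsDimerCovering m n D) :
    ∑ b, twistCoeff b * ((∏ e ∈ D, twistedSign b e) *
      coverSign orderSign Edge.src Edge.tgt halfCrossing ∅ D) = 1 := by
  simp only [twisted_coverSign hn hD]
  generalize ∑ e ∈ D, iv (wrapX e) = p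
  generalize ∑ e ∈ D, iv (wrapY e) = q
  simp only [Fintype.sum_prod_type, Fintype.sum_bool, twistCoeff, twistSign]
  rcases Nat.even_or_odd p with hp | hp <;> rcases Nat.even_or_odd q with hq | hq <;>
    simp [hp.neg_one_pow, hq.neg_one_pow, pow_add, pow_mul] <;> norm_num

theorem abs_coverSign {D : Finset (Edge (ZMod m) (ZMod n))} (hn : 2 ≤ n)
    (hD : IsDimerCovering m n D) (b : Bool × Bool) :
    |(∏ e ∈ D, twistedSign b e) * coverSign orderSign Edge.src Edge.tgt halfCrossing ∅ D| = 1 := by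
  have h : ∀ b, |twistSign b| = 1 := by intro b; cases b <;> simp [twistSign]
  rw [twisted_coverSign hn hD]
  simp [abs_mul, abs_pow, h]

/-- The horizontal edges of weight one leaving the vertices with `t = 1` form a covering, so the
partition function is positive even for `α = 0`. -/
theorem partitionFunction_pos {α : ℝ} (hα : 0 ≤ α) : 0 < partitionFunction m n α := by
  unfold partitionFunction
  refine Finset.sum_pos' (fun D _ => Finset.prod_nonneg fun e _ => weight_nonneg hα e) ?_
  refine ⟨Finset.univ.filter fun e => e.1.2.2 = 1 ∧ e.2 = Dir.hor, ?_, ?_⟩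
  · simp only [coverings, Finset.mem_filter, Finset.mem_univ, true_and]
    intro v
    obtain ⟨x, y, t⟩ := v
    rw [Finset.filter_filter, Finset.filter_filter]
    have h0 : ∀ p : Edge (ZMod m) (ZMod n) → Prop, ∀ [DecidablePred p], ∀ a,
        (∀ e, p e ↔ e = a) → (Finset.univ.filter p).card = 1 := by
      intro p _ a h
      rw [Finset.card_eq_one]
      exact ⟨a, by ext e; simp [h]⟩
    have h1 : ∀ p : Edge (ZMod m) (ZMod n) → Prop, ∀ [DecidablePred p],
        (∀ e, ¬ p e) → (Finset.univ.filter p).card = 0 := by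
      intro p _ h
      rw [Finset.card_eq_zero]
      ext e; simp [h]
    by_cases ht : t = 0
    · subst ht
      rw [h1, h0 _ ((x - 1, y, 1), Dir.hor)]
      · rintro ⟨⟨x', y', t'⟩, d⟩
        constructor
        · rintro ⟨⟨h1, h2⟩, h3⟩
          simp only at h1 h2
          subst h1 h2
          simp [Edge.tgt] at h3
          simp [← h3.1, h3.2]
        · intro h
          simp only [Prod.mk.injEq] at h
          obtain ⟨⟨rfl, rfl, rfl⟩, rfl⟩ := h
          simp [Edge.tgt]
      · rintro ⟨⟨x', y', t'⟩, d⟩ ⟨⟨h1, h2⟩, h3⟩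
        simp_all [Edge.src]
    · have ht1 : t = 1 := by omega
      subst ht1
      rw [h0 _ ((x, y, 1), Dir.hor), h1]
      · rintro ⟨⟨x', y', t'⟩, d⟩ ⟨⟨h1, h2⟩, h3⟩
        simp only at h1 h2
        subst h1 h2
        simp [Edge.tgt] at h3
      · rintro ⟨⟨x', y', t'⟩, d⟩
        simp only [Edge.src, Prod.mk.injEq]
        tauto
  · refine Finset.prod_pos ?_
    rintro ⟨⟨x, y, t⟩, d⟩ he
    simp only [Finset.mem_filter, Finset.mem_univ, true_and] at he
    obtain ⟨rfl, rfl⟩ := he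
    simp [Edge.weight]

/-- Wick's expression, in the inverse of `K`, for the joint occupation of the edges `e` and `f`. -/
def pairTerm {V E : Type*} [Fintype V] [DecidableEq V] (s t : E → V) (κ : E → ℝ)
    (K : Matrix V V ℝ) (e f : E) : ℝ :=
  κ e * κ f * (K⁻¹ (s e) (t e) * K⁻¹ (s f) (t f) - K⁻¹ (s e) (s f) * K⁻¹ (t e) (t f) +
    K⁻¹ (s e) (t f) * K⁻¹ (t e) (s f))

theorem sum_coverings (α : ℝ) (f : Finset (Edge (ZMod m) (ZMod n)) → ℝ) (hn : 2 ≤ n) :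
    ∑ D ∈ coverings m n, (∏ e ∈ D, Edge.weight α e) * f D =
      ∑ b, twistCoeff b * ∑ D ∈ coverings m n, (∏ e ∈ D, twistedWeight α b e) *
        coverSign orderSign Edge.src Edge.tgt halfCrossing ∅ D * f D := by
  simp only [Finset.mul_sum]
  rw [Finset.sum_comm]
  refine Finset.sum_congr rfl fun D hD => ?_
  have hD' : IsDimerCovering m n D := by simpa [coverings] using hD
  unfold twistedWeight
  simp only [Finset.prod_mul_distrib]
  have := sum_twistCoeff hn hD'
  calc _ = (∑ b, twistCoeff b * ((∏ e ∈ D, twistedSign b e) *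
      coverSign orderSign Edge.src Edge.tgt halfCrossing ∅ D)) *
        ((∏ e ∈ D, Edge.weight α e) * f D) := by rw [this, one_mul]
    _ = _ := by
      rw [Finset.sum_mul]
      exact Finset.sum_congr rfl fun b _ => by ring

/-- One- and two-dimer expectations are combinations of the Wick expressions of the four boundary
conditions. The coefficients are `±Z_b / (2 Z)`, with the vacuum amplitude `Z_b` of the full state
in place of the partition function. -/
theorem exists_mixture {α : ℝ} (hα : 0 ≤ α) (hn : 2 ≤ n)
    (hK : ∀ b, IsUnit (twistedKasteleyn m n α b).det) :
    ∃ p : Bool × Bool → ℝ, (∀ b, |p b| ≤ 1 / 2) ∧ ∑ b, p b = 1 ∧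
      (∀ e, expectation m n α (occupation m n e) =
        ∑ b, p b * -(twistedWeight α b e * (twistedKasteleyn m n α b)⁻¹ e.src e.tgt)) ∧
      (∀ e f, e ≠ f → expectation m n α (fun D => occupation m n e D * occupation m n f D) =
        ∑ b, p b * pairTerm Edge.src Edge.tgt (twistedWeight α b) (twistedKasteleyn m n α b)
          e f) := by
  classical
  set Z := partitionFunction m n α with hZ
  have hZpos : 0 < Z := partitionFunction_pos hα
  set φ : Bool × Bool → ℝ := fun b => vac orderSign Edge.src Edge.tgt
    (twistedWeight (m := m) (n := n) α b) (fullState _) with hφ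
  have hcov : (Finset.univ.filter (Covers Edge.src Edge.tgt ∅) :
      Finset (Finset (Edge (ZMod m) (ZMod n)))) = coverings m n := by
    ext D
    simp [coverings, covers_iff]
  have hφ1 : ∀ b, φ b = ∑ D ∈ coverings m n, (∏ e ∈ D, twistedWeight α b e) *
        coverSign orderSign Edge.src Edge.tgt halfCrossing ∅ D := by
    intro b
    rw [hφ, ← hcov]
    simp only
    rw [vac_fullState isHalfCrossing]
  have hφ2 : ∀ b e, ∑ D ∈ coverings m n, (∏ e ∈ D, twistedWeight α b e) *
        coverSign orderSign Edge.src Edge.tgt halfCrossing ∅ D * occupation m n e D =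
      -(twistedWeight α b e * (twistedKasteleyn m n α b)⁻¹ e.src e.tgt) * φ b := by
    intro b e
    have h := vac_pair isOrderSign isHalfCrossing (twistedWeight (m := m) (n := n) α b) e
    rw [vac_two isOrderSign _ (hK b), hcov] at h
    unfold occupation twistedKasteleyn
    rw [← h]
    ring
  have hφ3 : ∀ b e f, e ≠ f → ∑ D ∈ coverings m n, (∏ e ∈ D, twistedWeight α b e) *
        coverSign orderSign Edge.src Edge.tgt halfCrossing ∅ D *
          (occupation m n e D * occupation m n f D) =
      pairTerm Edge.src Edge.tgt (twistedWeight α b) (twistedKasteleyn m n α b) e f * φ b := by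
    intro b e f hef
    have h := vac_pair_pair isOrderSign isHalfCrossing
      (twistedWeight (m := m) (n := n) α b) e f hef
    rw [vac_four isOrderSign _ (hK b), hcov] at h
    unfold occupation twistedKasteleyn pairTerm
    rw [← h]
    ring
  refine ⟨fun b => twistCoeff b * φ b / Z, ?_, ?_, ?_, ?_⟩
  · intro b
    have h1 : |φ b| ≤ Z := by
      rw [hφ1, hZ, partitionFunction]
      refine (Finset.abs_sum_le_sum_abs _ _).trans (Finset.sum_le_sum fun D hD => ?_)
      have hD' : IsDimerCovering m n D := by simpa [coverings] using hD
      unfold twistedWeight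
      rw [Finset.prod_mul_distrib, mul_right_comm, abs_mul, abs_coverSign hn hD', one_mul,
        abs_of_nonneg (Finset.prod_nonneg fun e _ => weight_nonneg hα e)]
    have h2 : |twistCoeff b| = 1 / 2 := by
      unfold twistCoeff
      split_ifs <;> norm_num [abs_div]
    rw [abs_div, abs_mul, h2, abs_of_pos hZpos, div_le_iff₀ hZpos]
    linarith
  · rw [← Finset.sum_div, div_eq_one_iff_eq hZpos.ne', hZ, partitionFunction]
    have := sum_coverings (m := m) (n := n) α (fun _ => 1) hn
    simp only [mul_one, ← hφ1] at this
    exact this.symm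
  · intro e
    rw [expectation, sum_coverings α _ hn]
    simp only [hφ2]
    rw [Finset.sum_div]
    refine Finset.sum_congr rfl fun b _ => ?_
    ring
  · intro e f hef
    rw [expectation, sum_coverings α _ hn]
    simp only [fun b => hφ3 b e f hef]
    rw [Finset.sum_div]
    refine Finset.sum_congr rfl fun b _ => ?_
    ring

end Mixture

/-! ### Zeros of the characteristic polynomial -/

section Symbol

theorem inv_eq_conj_of_norm {w : ℂ} (hw : ‖w‖ = 1) : w⁻¹ = (starRingEnd ℂ) w := by
  rw [Complex.inv_def, Complex.normSq_eq_norm_sq, hw]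
  simp

/-- On the unit torus the magnetic Kasteleyn matrix is skew-Hermitian, and its determinant is a sum
of two squared moduli. -/
theorem charPoly_eq_normSq (α : ℝ) {w z : ℂ} (hw : ‖w‖ = 1) (hz : ‖z‖ = 1) :
    charPoly α w z =
      ((Complex.normSq (z - z⁻¹) + Complex.normSq (α - z - w⁻¹ - z⁻¹ * w⁻¹) : ℝ) : ℂ) := by
  rw [charPoly, magneticKasteleyn, Matrix.det_fin_two_of]
  push_cast
  rw [← Complex.mul_conj, ← Complex.mul_conj, inv_eq_conj_of_norm hw, inv_eq_conj_of_norm hz]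
  simp only [map_sub, map_mul, Complex.conj_conj, Complex.conj_ofReal]
  ring

theorem charPoly_eq_zero_iff {α : ℝ} (hα : 0 ≤ α) {w z : ℂ} (hw : ‖w‖ = 1) (hz : ‖z‖ = 1) :
    charPoly α w z = 0 ↔ α = 3 ∧ w = 1 ∧ z = 1 := by
  constructor
  · intro h
    rw [charPoly_eq_normSq α hw hz, Complex.ofReal_eq_zero] at h
    have h1 := Complex.normSq_nonneg (z - z⁻¹)
    have h2 := Complex.normSq_nonneg (α - z - w⁻¹ - z⁻¹ * w⁻¹)
    have hz1 : z - z⁻¹ = 0 := Complex.normSq_eq_zero.mp (by linarith)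
    have hA : α - z - w⁻¹ - z⁻¹ * w⁻¹ = 0 := Complex.normSq_eq_zero.mp (by linarith)
    have hz0 : z ≠ 0 := by rintro rfl; simp at hz
    have hw0 : w ≠ 0 := by rintro rfl; simp at hw
    have hzz : z * z = 1 := by
      have := sub_eq_zero.mp hz1
      calc z * z = z * z⁻¹ := by rw [← this]
        _ = 1 := mul_inv_cancel₀ hz0
    -- For `z = 1` the second square gives `w⁻¹ = (α - 1) / 2`, of modulus one; for `z = -1` it
    -- gives `α = -1`.
    rcases mul_self_eq_one_iff.mp hzz with rfl | rfl
    · have h3 : w⁻¹ = (((α - 1) / 2 : ℝ) : ℂ) := by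
        push_cast
        rw [inv_one, one_mul] at hA
        linear_combination -(1 / 2 : ℂ) * hA
      have h4 : ‖w⁻¹‖ = 1 := by rw [norm_inv, hw, inv_one]
      rw [h3, Complex.norm_real, Real.norm_eq_abs] at h4
      have h5 : α = 3 := by
        rcases (abs_eq zero_le_one).mp h4 with h | h <;> linarith
      subst h5
      refine ⟨rfl, ?_, rfl⟩
      rw [← inv_inv w, h3]
      norm_num
    · exfalso
      have h3 : ((α + 1 : ℝ) : ℂ) = 0 := by
        push_cast
        rw [show ((-1 : ℂ))⁻¹ = -1 by norm_num] at hA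
        linear_combination hA
      rw [Complex.ofReal_eq_zero] at h3
      linarith
  · rintro ⟨rfl, rfl, rfl⟩
    rw [charPoly, magneticKasteleyn, Matrix.det_fin_two_of]
    norm_num

theorem charPoly_exp_eq_zero_iff {α : ℝ} (hα : 0 ≤ α) (kx ky : ℝ) :
    charPoly α (Complex.exp (kx * Complex.I)) (Complex.exp (ky * Complex.I)) = 0 ↔
      α = 3 ∧ (∃ a : ℤ, kx = 2 * Real.pi * a) ∧ ∃ b : ℤ, ky = 2 * Real.pi * b := by
  have h : ∀ k : ℝ, Complex.exp (k * Complex.I) = 1 ↔ ∃ a : ℤ, k = 2 * Real.pi * a := by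
    intro k
    rw [Complex.exp_eq_one_iff]
    refine exists_congr fun a => ?_
    rw [show (a : ℂ) * (2 * Real.pi * Complex.I) = ((2 * Real.pi * a : ℝ) : ℂ) * Complex.I by
      push_cast; ring, mul_left_inj' Complex.I_ne_zero, Complex.ofReal_inj]
  rw [charPoly_eq_zero_iff hα (Complex.norm_exp_ofReal_mul_I kx) (Complex.norm_exp_ofReal_mul_I ky),
    h, h]

end Symbol

/-! ### Plane waves on the torus -/

section PlaneWaves

theorem sum_dir {M : Type*} [AddCommMonoid M] (f : Dir → M) :
    ∑ d, f d = f Dir.hor + f Dir.ver + f Dir.diag := by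
  rw [show (Finset.univ : Finset Dir) = {Dir.hor, Dir.ver, Dir.diag} from rfl,
    Finset.sum_insert (by decide), Finset.sum_insert (by decide), Finset.sum_singleton, add_assoc]

variable {m n : ℕ} [NeZero m] [NeZero n]

omit [NeZero m] [NeZero n] in
theorem tgt_eq_zero_iff {x x' : ZMod m} {y y' : ZMod n} {t : Fin 2} {d : Dir} :
    Edge.tgt ((x', y', t), d) = (x, y, 0) ↔
      (d = Dir.hor ∧ (x', y', t) = (x - 1, y, 1)) ∨ (d = Dir.ver ∧ (x', y', t) = (x, y - 1, 0)) ∨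
        (d = Dir.diag ∧ (x', y', t) = (x - 1, y - 1, 1)) := by
  fin_cases t <;> cases d <;> simp [Edge.tgt, eq_sub_iff_add_eq]

omit [NeZero m] [NeZero n] in
theorem tgt_eq_one_iff {x x' : ZMod m} {y y' : ZMod n} {t : Fin 2} {d : Dir} :
    Edge.tgt ((x', y', t), d) = (x, y, 1) ↔
      (d = Dir.hor ∧ (x', y', t) = (x, y, 0)) ∨ (d = Dir.ver ∧ (x', y', t) = (x, y - 1, 1)) ∨
        (d = Dir.diag ∧ (x', y', t) = (x, y - 1, 0)) := by
  fin_cases t <;> cases d <;> simp [Edge.tgt, eq_sub_iff_add_eq]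

theorem sum_src (u : Vertex (ZMod m) (ZMod n)) (f : Edge (ZMod m) (ZMod n) → ℂ) :
    (∑ e : Edge (ZMod m) (ZMod n), if Edge.src e = u then f e else 0) =
      f (u, Dir.hor) + f (u, Dir.ver) + f (u, Dir.diag) := by
  rw [Fintype.sum_prod_type, Finset.sum_eq_single u, sum_dir]
  · simp [Edge.src]
  · intro v _ hv
    exact Finset.sum_eq_zero fun d _ => if_neg hv
  · simp

theorem sum_tgt_zero (x : ZMod m) (y : ZMod n) (f : Edge (ZMod m) (ZMod n) → ℂ) :
    (∑ e : Edge (ZMod m) (ZMod n), if Edge.tgt e = (x, y, 0) then f e else 0) =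
      f ((x - 1, y, 1), Dir.hor) + f ((x, y - 1, 0), Dir.ver) +
        f ((x - 1, y - 1, 1), Dir.diag) := by
  rw [Fintype.sum_prod_type_right, sum_dir]
  congr 1
  · congr 1
    · rw [Finset.sum_eq_single (x - 1, y, 1)]
      · rw [if_pos (tgt_eq_zero_iff.mpr (by simp))]
      · rintro ⟨x', y', t⟩ _ hv
        rw [if_neg]
        rw [tgt_eq_zero_iff]
        simp [hv]
      · simp
    · rw [Finset.sum_eq_single (x, y - 1, 0)]
      · rw [if_pos (tgt_eq_zero_iff.mpr (by simp))]
      · rintro ⟨x', y', t⟩ _ hv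
        rw [if_neg]
        rw [tgt_eq_zero_iff]
        simp [hv]
      · simp
  · rw [Finset.sum_eq_single (x - 1, y - 1, 1)]
    · rw [if_pos (tgt_eq_zero_iff.mpr (by simp))]
    · rintro ⟨x', y', t⟩ _ hv
      rw [if_neg]
      rw [tgt_eq_zero_iff]
      simp [hv]
    · simp

theorem sum_tgt_one (x : ZMod m) (y : ZMod n) (f : Edge (ZMod m) (ZMod n) → ℂ) :
    (∑ e : Edge (ZMod m) (ZMod n), if Edge.tgt e = (x, y, 1) then f e else 0) =
      f ((x, y, 0), Dir.hor) + f ((x, y - 1, 1), Dir.ver) + f ((x, y - 1, 0), Dir.diag) := by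
  rw [Fintype.sum_prod_type_right, sum_dir]
  congr 1
  · congr 1
    · rw [Finset.sum_eq_single (x, y, 0)]
      · rw [if_pos (tgt_eq_one_iff.mpr (by simp))]
      · rintro ⟨x', y', t⟩ _ hv
        rw [if_neg]
        rw [tgt_eq_one_iff]
        simp [hv]
      · simp
    · rw [Finset.sum_eq_single (x, y - 1, 1)]
      · rw [if_pos (tgt_eq_one_iff.mpr (by simp))]
      · rintro ⟨x', y', t⟩ _ hv
        rw [if_neg]
        rw [tgt_eq_one_iff]
        simp [hv]
      · simp
  · rw [Finset.sum_eq_single (x, y - 1, 0)]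
    · rw [if_pos (tgt_eq_one_iff.mpr (by simp))]
    · rintro ⟨x', y', t⟩ _ hv
      rw [if_neg]
      rw [tgt_eq_one_iff]
      simp [hv]
    · simp

theorem sum_skewMatrix_mul {V E : Type*} [Fintype V] [DecidableEq V] [Fintype E] (s t : E → V)
    (κ : E → ℝ) (ψ : V → ℂ) (u : V) :
    ∑ v, (skewMatrix s t κ u v : ℂ) * ψ v =
      (∑ e, if s e = u then (κ e : ℂ) * ψ (t e) else 0) -
        ∑ e, if t e = u then (κ e : ℂ) * ψ (s e) else 0 := by
  have h1 : ∀ p q : E → V, ∑ v, (∑ e, if p e = u ∧ q e = v then (κ e : ℂ) else 0) * ψ v =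
      ∑ e, if p e = u then (κ e : ℂ) * ψ (q e) else 0 := by
    intro p q
    simp only [Finset.sum_mul]
    rw [Finset.sum_comm]
    refine Finset.sum_congr rfl fun e _ => ?_
    rw [Finset.sum_eq_single (q e)]
    · by_cases h : p e = u <;> simp [h]
    · intro v _ hv
      simp [Ne.symm hv]
    · simp
  rw [← h1 s t, ← h1 t s, ← Finset.sum_sub_distrib]
  refine Finset.sum_congr rfl fun v _ => ?_
  have h2 : (∑ e, if t e = u ∧ s e = v then (κ e : ℂ) else 0) =
      ∑ e, if s e = v ∧ t e = u then (κ e : ℂ) else 0 :=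
    Finset.sum_congr rfl fun e _ => by simp only [and_comm]
  rw [← sub_mul, skewMatrix, h2]
  push_cast
  simp only [apply_ite Complex.ofReal, Complex.ofReal_zero]

/-- A plane wave with `w ^ k = ±1` translates correctly across the boundary because of the twist. -/
theorem wave_step {k : ℕ} [NeZero k] (b : Bool) {w : ℂ} (hw : w ^ k = (twistSign b : ℂ))
    (x : ZMod k) :
    (twistSign b : ℂ) ^ iv (x.val + 1 = k) * w ^ (x + 1).val = w ^ x.val * w := by
  rw [← pow_succ]
  rcases val_add_one_cases x with ⟨h1, h2⟩ | ⟨h1, h2⟩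
  · rw [h1, h2, hw, show iv (k = k) = 1 by simp [iv]]
    simp
  · rw [h2, show iv (x.val + 1 = k) = 0 by simp [iv, h1.ne]]
    simp

theorem wave_step_back {k : ℕ} [NeZero k] (b : Bool) {w : ℂ} (hw0 : w ≠ 0)
    (hw : w ^ k = (twistSign b : ℂ)) (x : ZMod k) :
    (twistSign b : ℂ) ^ iv ((x - 1).val + 1 = k) * w ^ (x - 1).val = w ^ x.val * w⁻¹ := by
  have h := wave_step b hw (x - 1)
  rw [sub_add_cancel] at h
  have h2 : (twistSign b : ℂ) * (twistSign b : ℂ) = 1 := by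
    exact_mod_cast twistSign_mul_self b
  have h3 : (twistSign b : ℂ) ^ iv ((x - 1).val + 1 = k) *
      (twistSign b : ℂ) ^ iv ((x - 1).val + 1 = k) = 1 := by
    rw [← mul_pow, h2, one_pow]
  field_simp
  linear_combination (-(twistSign b : ℂ) ^ iv ((x - 1).val + 1 = k)) * h + w ^ x.val * h3

/-- On plane waves the twisted Kasteleyn matrix acts as the magnetic Kasteleyn matrix. -/
theorem sum_twistedKasteleyn_wave (α : ℝ) (b : Bool × Bool) {w z : ℂ} (hw0 : w ≠ 0) (hz0 : z ≠ 0)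
    (hw : w ^ m = (twistSign b.1 : ℂ)) (hz : z ^ n = (twistSign b.2 : ℂ)) (ξ : Fin 2 → ℂ)
    (u : Vertex (ZMod m) (ZMod n)) :
    ∑ v : Vertex (ZMod m) (ZMod n), (twistedKasteleyn m n α b u v : ℂ) *
        (w ^ v.1.val * z ^ v.2.1.val * ξ v.2.2) =
      w ^ u.1.val * z ^ u.2.1.val * ∑ s, magneticKasteleyn α w z u.2.2 s * ξ s := by
  obtain ⟨x, y, t⟩ := u
  unfold twistedKasteleyn
  rw [sum_skewMatrix_mul, sum_src]
  have hx1 := wave_step b.1 hw x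
  have hx2 := wave_step_back b.1 hw0 hw x
  have hy1 := wave_step b.2 hz y
  have hy2 := wave_step_back b.2 hz0 hz y
  have i0 : iv False = 0 := iv_false
  fin_cases t
  · rw [show ((x, y, (⟨0, by norm_num⟩ : Fin 2)) : Vertex (ZMod m) (ZMod n)) = (x, y, 0) from rfl]
    rw [sum_tgt_zero]
    simp only [twistedWeight, twistedSign, wrapX, wrapY, Edge.sign, Edge.weight, Edge.tgt, Edge.src,
      magneticKasteleyn, Fin.sum_univ_two]
    simp [i0]
    linear_combination (-ξ 1 * w ^ x.val) * hy1 + (ξ 0 * w ^ x.val) * hy1 -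
      (ξ 1 * z ^ y.val) * hx2 - (ξ 0 * w ^ x.val) * hy2 - (ξ 1 * z ^ y.val * z⁻¹) * hx2 -
      (ξ 1 * (twistSign b.1 : ℂ) ^ iv ((x - 1).val + 1 = m) * w ^ (x - 1).val) * hy2
  · rw [show ((x, y, (⟨1, by norm_num⟩ : Fin 2)) : Vertex (ZMod m) (ZMod n)) = (x, y, 1) from rfl]
    rw [sum_tgt_one]
    simp only [twistedWeight, twistedSign, wrapX, wrapY, Edge.sign, Edge.weight, Edge.tgt, Edge.src,
      magneticKasteleyn, Fin.sum_univ_two]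
    simp [i0]
    linear_combination (ξ 0 * z ^ y.val) * hx1 - (ξ 1 * w ^ x.val) * hy1 +
      (ξ 0 * z ^ y.val * z) * hx1 +
      (ξ 0 * (twistSign b.1 : ℂ) ^ iv (x.val + 1 = m) * w ^ (x + 1).val) * hy1 +
      (ξ 1 * w ^ x.val) * hy2 + (ξ 0 * w ^ x.val) * hy2

end PlaneWaves

/-! ### The inverse twisted Kasteleyn matrices in Fourier space -/

section Fourier

/-- The `j`-th quasi-momentum of `k` sites on a periodic (`b = false`) or antiperiodic circle. -/
def angle (k : ℕ) (b : Bool) (j : ℕ) : ℝ := 2 * Real.pi * (j + if b then 1 / 2 else 0) / k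

/-- The `j`-th solution of `w ^ k = ±1`. -/
def node (k : ℕ) (b : Bool) (j : ℕ) : ℂ := Complex.exp (angle k b j * Complex.I)

theorem norm_node (k : ℕ) (b : Bool) (j : ℕ) : ‖node k b j‖ = 1 :=
  Complex.norm_exp_ofReal_mul_I _

theorem node_ne_zero (k : ℕ) (b : Bool) (j : ℕ) : node k b j ≠ 0 := Complex.exp_ne_zero _

theorem node_pow (k : ℕ) [NeZero k] (b : Bool) (j : ℕ) : node k b j ^ k = (twistSign b : ℂ) := by
  have hk : (k : ℂ) ≠ 0 := Nat.cast_ne_zero.mpr (NeZero.ne k)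
  rw [node, ← Complex.exp_nat_mul, angle]
  cases b
  · simp only [twistSign, Bool.false_eq_true, if_false, Complex.ofReal_one]
    rw [Complex.exp_eq_one_iff]
    refine ⟨j, ?_⟩
    push_cast
    simp
    field_simp
  · rw [show (k : ℂ) * (((2 * Real.pi * (j + if true = true then 1 / 2 else 0) / k : ℝ) : ℂ) *
      Complex.I) = Real.pi * Complex.I + j * (2 * Real.pi * Complex.I) by
        push_cast
        simp
        field_simp
        ring]
    rw [Complex.exp_add, Complex.exp_pi_mul_I, Complex.exp_nat_mul_two_pi_mul_I]
    simp [twistSign]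

/-- Orthogonality of the plane waves on `k` sites. -/
theorem sum_node (k : ℕ) [NeZero k] (b : Bool) (x x' : ZMod k) :
    (1 / k : ℂ) * ∑ j ∈ Finset.range k, node k b j ^ x.val * (node k b j ^ x'.val)⁻¹ =
      if x = x' then 1 else 0 := by
  have hk : (k : ℂ) ≠ 0 := Nat.cast_ne_zero.mpr (NeZero.ne k)
  by_cases hxx : x = x'
  · subst hxx
    rw [Finset.sum_congr rfl (g := fun _ => (1 : ℂ))]
    · simp [hk]
    · intro j _
      exact mul_inv_cancel₀ (pow_ne_zero _ (node_ne_zero k b j))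
  · rw [if_neg hxx]
    set ζ := Complex.exp (2 * Real.pi * Complex.I / k) with hζ
    have hprim : IsPrimitiveRoot ζ k := Complex.isPrimitiveRoot_exp k (NeZero.ne k)
    have hζ0 : ζ ≠ 0 := Complex.exp_ne_zero _
    have hnode : ∀ j, node k b j = node k b 0 * ζ ^ j := by
      intro j
      rw [node, node, hζ, ← Complex.exp_nat_mul, ← Complex.exp_add, angle, angle]
      congr 1
      push_cast
      field_simp
      ring
    -- The sum is geometric, and its ratio is a root of unity other than one.
    set r := ζ ^ x.val * (ζ ^ x'.val)⁻¹ with hr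
    have hr1 : r ≠ 1 := by
      intro h
      have h2 : ζ ^ x.val = ζ ^ x'.val := by
        rw [hr] at h
        have h0 := pow_ne_zero x'.val hζ0
        field_simp at h
        exact h
      exact hxx (ZMod.val_injective k (hprim.pow_inj (ZMod.val_lt x) (ZMod.val_lt x') h2))
    have hrk : r ^ k = 1 := by
      rw [hr, mul_pow, inv_pow, ← pow_mul, ← pow_mul, mul_comm x.val, mul_comm x'.val, pow_mul,
        pow_mul, hprim.pow_eq_one]
      simp
    have hsum : ∑ j ∈ Finset.range k, r ^ j = 0 := by
      have h := geom_sum_mul r k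
      rw [hrk, sub_self] at h
      exact (mul_eq_zero.mp h).resolve_right (sub_ne_zero.mpr hr1)
    have hterm : ∀ j ∈ Finset.range k, node k b j ^ x.val * (node k b j ^ x'.val)⁻¹ =
        (node k b 0 ^ x.val * (node k b 0 ^ x'.val)⁻¹) * r ^ j := by
      intro j _
      rw [hnode j, hr, mul_pow, mul_pow, mul_pow, mul_inv, inv_pow, ← pow_mul, ← pow_mul,
        ← pow_mul, ← pow_mul, mul_comm j, mul_comm j]
      ring
    rw [Finset.sum_congr rfl hterm, ← Finset.mul_sum, hsum]
    simp

variable (m n : ℕ) [NeZero m] [NeZero n]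

/-- The inverse of the twisted Kasteleyn matrix, as a Fourier sum. -/
def torusInverse (α : ℝ) (b : Bool × Bool) :
    Matrix (Vertex (ZMod m) (ZMod n)) (Vertex (ZMod m) (ZMod n)) ℂ := fun u v =>
  1 / (m * n : ℂ) * ∑ j ∈ Finset.range m, ∑ k ∈ Finset.range n,
    (magneticKasteleyn α (node m b.1 j) (node n b.2 k))⁻¹ u.2.2 v.2.2 *
      (node m b.1 j ^ u.1.val * (node m b.1 j ^ v.1.val)⁻¹ *
        (node n b.2 k ^ u.2.1.val * (node n b.2 k ^ v.2.1.val)⁻¹))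

theorem charPoly_ne_zero {α : ℝ} (hα : 0 ≤ α) (h3 : α ≠ 3) {w z : ℂ} (hw : ‖w‖ = 1)
    (hz : ‖z‖ = 1) : charPoly α w z ≠ 0 := fun h =>
  h3 ((charPoly_eq_zero_iff hα hw hz).mp h).1

theorem twistedKasteleyn_mul_torusInverse {α : ℝ} (hα : 0 ≤ α) (h3 : α ≠ 3) (b : Bool × Bool) :
    (twistedKasteleyn m n α b).map Complex.ofReal * torusInverse m n α b = 1 := by
  ext u v
  simp only [Matrix.mul_apply, Matrix.map_apply, torusInverse, Finset.mul_sum]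
  rw [Finset.sum_comm]
  have hstep : ∀ j ∈ Finset.range m, ∀ k ∈ Finset.range n,
      ∑ i : Vertex (ZMod m) (ZMod n), (twistedKasteleyn m n α b u i : ℂ) * (1 / (m * n : ℂ) *
      ((magneticKasteleyn α (node m b.1 j) (node n b.2 k))⁻¹ i.2.2 v.2.2 *
        (node m b.1 j ^ i.1.val * (node m b.1 j ^ v.1.val)⁻¹ *
          (node n b.2 k ^ i.2.1.val * (node n b.2 k ^ v.2.1.val)⁻¹)))) =
      (if u.2.2 = v.2.2 then 1 else 0) *
        ((1 / m * (node m b.1 j ^ u.1.val * (node m b.1 j ^ v.1.val)⁻¹)) *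
        (1 / n * (node n b.2 k ^ u.2.1.val * (node n b.2 k ^ v.2.1.val)⁻¹))) := by
    intro j _ k _
    set w := node m b.1 j
    set z := node n b.2 k
    have hunit : IsUnit (magneticKasteleyn α w z).det :=
      isUnit_iff_ne_zero.mpr (charPoly_ne_zero hα h3 (norm_node _ _ _) (norm_node _ _ _))
    have h1 := sum_twistedKasteleyn_wave (m := m) (n := n) α b (w := w) (z := z)
      (node_ne_zero _ _ _) (node_ne_zero _ _ _) (node_pow _ _ _) (node_pow _ _ _)
      (fun s => (magneticKasteleyn α w z)⁻¹ s v.2.2) u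
    have h2 : ∑ s, magneticKasteleyn α w z u.2.2 s * (magneticKasteleyn α w z)⁻¹ s v.2.2 =
        if u.2.2 = v.2.2 then 1 else 0 := by
      rw [← Matrix.mul_apply, Matrix.mul_nonsing_inv _ hunit, Matrix.one_apply]
    rw [h2] at h1
    calc _ = (∑ i : Vertex (ZMod m) (ZMod n), (twistedKasteleyn m n α b u i : ℂ) *
          (w ^ i.1.val * z ^ i.2.1.val * (magneticKasteleyn α w z)⁻¹ i.2.2 v.2.2)) *
          (1 / (m * n : ℂ) * ((w ^ v.1.val)⁻¹ * (z ^ v.2.1.val)⁻¹)) := by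
          rw [Finset.sum_mul]
          exact Finset.sum_congr rfl fun i _ => by ring
      _ = _ := by
          rw [h1]
          ring
  rw [Finset.sum_congr rfl fun j hj => Finset.sum_comm.trans
    (Finset.sum_congr rfl fun k hk => hstep j hj k hk)]
  simp only [← Finset.mul_sum]
  rw [← Finset.sum_mul, ← Finset.mul_sum, sum_node, sum_node, Matrix.one_apply]
  obtain ⟨x, y, t⟩ := u
  obtain ⟨x', y', t'⟩ := v
  simp only [Prod.mk.injEq]
  split_ifs <;> simp_all

theorem isUnit_det_twistedKasteleyn {α : ℝ} (hα : 0 ≤ α) (h3 : α ≠ 3) (b : Bool × Bool) :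
    IsUnit (twistedKasteleyn m n α b).det := by
  have h := congrArg Matrix.det (twistedKasteleyn_mul_torusInverse m n hα h3 b)
  rw [Matrix.det_mul, Matrix.det_one] at h
  have h2 : ((twistedKasteleyn m n α b).map Complex.ofReal).det =
      (((twistedKasteleyn m n α b).det : ℝ) : ℂ) :=
    (RingHom.map_det Complex.ofRealHom _).symm
  rw [isUnit_iff_ne_zero]
  intro h0
  rw [h2, h0] at h
  simp at h

theorem inv_twistedKasteleyn {α : ℝ} (hα : 0 ≤ α) (h3 : α ≠ 3) (b : Bool × Bool)
    (u v : Vertex (ZMod m) (ZMod n)) :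
    (((twistedKasteleyn m n α b)⁻¹ u v : ℝ) : ℂ) = torusInverse m n α b u v := by
  have h1 := Matrix.nonsing_inv_mul _ (isUnit_det_twistedKasteleyn m n hα h3 b)
  have h2 : ((twistedKasteleyn m n α b)⁻¹).map Complex.ofReal *
      (twistedKasteleyn m n α b).map Complex.ofReal = 1 := by
    have := congrArg (fun M => M.map Complex.ofRealHom) h1
    rw [Matrix.map_mul, Matrix.map_one _ (map_zero _) (map_one _)] at this
    exact this
  have h3 := left_inv_eq_right_inv h2 (twistedKasteleyn_mul_torusInverse m n hα h3 b)
  exact congrFun (congrFun h3 u) v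

/-- The integrand of `inverseKasteleyn`. -/
def fourierIntegrand (α : ℝ) (u v : Vertex ℤ ℤ) (kx ky : ℝ) : ℂ :=
  (magneticKasteleyn α (Complex.exp (kx * Complex.I)) (Complex.exp (ky * Complex.I)))⁻¹
      u.2.2 v.2.2 *
    Complex.exp (-Complex.I * (kx * ((v.1 - u.1 : ℤ) : ℂ) + ky * ((v.2.1 - u.2.1 : ℤ) : ℂ)))

/-- The Riemann sum of the Fourier integral over the quasi-momenta of the `m × n` torus with
boundary conditions `b`. -/
def latticeInverse (α : ℝ) (b : Bool × Bool) (u v : Vertex ℤ ℤ) : ℂ :=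
  1 / (m * n : ℂ) * ∑ j ∈ Finset.range m, ∑ k ∈ Finset.range n,
    fourierIntegrand α u v (angle m b.1 j) (angle n b.2 k)

/-- The boundary sign between a vertex of the infinite lattice and its representative in the
cut-open torus. The quotients are floor divisions, the numbers of periods between the two. -/
def gauge (b : Bool × Bool) (u : Vertex ℤ ℤ) : ℝ :=
  twistSign b.1 ^ (u.1 / (m : ℤ)) * twistSign b.2 ^ (u.2.1 / (n : ℤ))

theorem twistSign_ne_zero (b : Bool) : twistSign b ≠ 0 := by cases b <;> simp [twistSign]

theorem twistSign_zpow_mul_self (b : Bool) (q : ℤ) : twistSign b ^ q * twistSign b ^ q = 1 := by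
  rw [← mul_zpow, twistSign_mul_self, one_zpow]

omit [NeZero m] [NeZero n] in
theorem gauge_false (u : Vertex ℤ ℤ) : gauge m n (false, false) u = 1 := by
  simp [gauge, twistSign]

theorem node_zpow (k : ℕ) [NeZero k] (b : Bool) (j : ℕ) (x : ℤ) :
    node k b j ^ x = ((twistSign b ^ (x / (k : ℤ)) : ℝ) : ℂ) * node k b j ^ (x : ZMod k).val := by
  have h : x = ((x : ZMod k).val : ℤ) + k * (x / (k : ℤ)) := by
    rw [ZMod.val_intCast, Int.emod_add_mul_ediv]
  conv_lhs => rw [h]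
  rw [zpow_add₀ (node_ne_zero _ _ _), zpow_mul, zpow_natCast, zpow_natCast, node_pow]
  push_cast
  ring

/-- The plane waves live on the infinite lattice, the matrix on the torus: the two differ by the
gauge signs. -/
theorem latticeInverse_eq (α : ℝ) (b : Bool × Bool) (u v : Vertex ℤ ℤ) :
    latticeInverse m n α b u v = ((gauge m n b u * gauge m n b v : ℝ) : ℂ) *
      torusInverse m n α b (Vertex.proj m n u) (Vertex.proj m n v) := by
  unfold latticeInverse torusInverse
  rw [mul_left_comm (Complex.ofReal _)]
  congr 1
  simp only [Finset.mul_sum]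
  refine Finset.sum_congr rfl fun j _ => Finset.sum_congr rfl fun k _ => ?_
  have hinv : ∀ (b : Bool) (q : ℤ), (twistSign b ^ q)⁻¹ = twistSign b ^ q := fun b q =>
    inv_eq_of_mul_eq_one_left (twistSign_zpow_mul_self b q)
  have he : Complex.exp (-Complex.I * ((angle m b.1 j : ℂ) * ((v.1 - u.1 : ℤ) : ℂ) +
      (angle n b.2 k : ℂ) * ((v.2.1 - u.2.1 : ℤ) : ℂ))) =
      node m b.1 j ^ u.1 * (node m b.1 j ^ v.1)⁻¹ *
        (node n b.2 k ^ u.2.1 * (node n b.2 k ^ v.2.1)⁻¹) := by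
    rw [← zpow_neg, ← zpow_neg, node, node, ← Complex.exp_int_mul, ← Complex.exp_int_mul,
      ← Complex.exp_int_mul, ← Complex.exp_int_mul, ← Complex.exp_add, ← Complex.exp_add,
      ← Complex.exp_add]
    congr 1
    push_cast
    ring
  rw [fourierIntegrand, he, node_zpow, node_zpow, node_zpow, node_zpow, mul_inv, mul_inv,
    ← Complex.ofReal_inv, ← Complex.ofReal_inv, hinv, hinv]
  simp only [gauge, Vertex.proj, node]
  push_cast
  ring

/-- The gauge changes along an edge exactly if the edge wraps around. -/
theorem twistSign_step (k : ℕ) [NeZero k] (b : Bool) (x : ℤ) :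
    twistSign b ^ iv ((x : ZMod k).val + 1 = k) =
      twistSign b ^ (x / (k : ℤ)) * twistSign b ^ ((x + 1) / (k : ℤ)) := by
  have hk : (0 : ℤ) < k := by exact_mod_cast Nat.pos_of_ne_zero (NeZero.ne k)
  have h := ZMod.val_intCast (n := k) x
  have h0 := Int.emod_add_mul_ediv x k
  have hpos := Int.emod_nonneg x hk.ne'
  have hlt := Int.emod_lt_of_pos x hk
  rw [← zpow_add₀ (twistSign_ne_zero b)]
  by_cases hw : (x : ZMod k).val + 1 = k
  -- At the end of a period the floor quotient increases by one.
  · have h1 : (x + 1) / (k : ℤ) = x / k + 1 := by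
      have h2 : x + 1 = k * (x / k + 1) := by
        have : (((x : ZMod k).val : ℤ)) + 1 = k := by exact_mod_cast hw
        rw [h] at this
        linear_combination -h0 + this
      rw [h2, Int.mul_ediv_cancel_left _ hk.ne']
    have h2 : x / (k : ℤ) + (x / k + 1) = 2 * (x / k) + 1 := by ring
    rw [h1, h2, zpow_add₀ (twistSign_ne_zero b), zpow_mul]
    have h3 : twistSign b ^ (2 : ℤ) = 1 := by
      rw [zpow_two, twistSign_mul_self]
    rw [h3]
    simp [iv, hw]
  · have h1 : (x + 1) / (k : ℤ) = x / k := by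
      have hlt' : x % k + 1 < k := by
        rcases lt_or_eq_of_le (Int.add_one_le_iff.mpr hlt) with h' | h'
        · exact h'
        · exfalso
          apply hw
          rw [← h] at h'
          exact_mod_cast h'
      have h2 : x + 1 = (x % k + 1) + k * (x / k) := by linear_combination -h0
      rw [h2, Int.add_mul_ediv_left _ _ hk.ne', Int.ediv_eq_zero_of_lt (by omega) hlt', zero_add]
    rw [h1, ← two_mul, zpow_mul, zpow_two, twistSign_mul_self, one_zpow]
    simp [iv, hw]

omit [NeZero m] [NeZero n] in
theorem proj_tgt (e : Edge ℤ ℤ) : Edge.tgt (Edge.proj m n e) = Vertex.proj m n (Edge.tgt e) := by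
  obtain ⟨⟨x, y, t⟩, d⟩ := e
  fin_cases t <;> cases d <;> simp [Edge.tgt, Edge.proj, Vertex.proj]

omit [NeZero m] [NeZero n] in
theorem proj_src (e : Edge ℤ ℤ) : Edge.src (Edge.proj m n e) = Vertex.proj m n (Edge.src e) := rfl

theorem twistedWeight_proj (α : ℝ) (b : Bool × Bool) (e : Edge ℤ ℤ) :
    twistedWeight α b (Edge.proj m n e) =
      gauge m n b (Edge.src e) * gauge m n b (Edge.tgt e) * (Edge.sign e * Edge.weight α e) := by
  obtain ⟨⟨x, y, t⟩, d⟩ := e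
  have hx := twistSign_step m b.1 x
  have hy := twistSign_step n b.2 y
  have hx1 := twistSign_zpow_mul_self b.1 (x / (m : ℤ))
  have hy1 := twistSign_zpow_mul_self b.2 (y / (n : ℤ))
  have i0 : iv False = 0 := iv_false
  fin_cases t <;> cases d <;>
    simp [twistedWeight, twistedSign, wrapX, wrapY, Edge.proj, Vertex.proj, Edge.sign,
      Edge.weight, Edge.tgt, Edge.src, gauge, i0, hx, hy, -mul_eq_mul_left_iff]
  · linear_combination
      (-(twistSign b.2 ^ (y / (n : ℤ)) * twistSign b.2 ^ (y / (n : ℤ)) * α)) * hx1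
      - α * hy1
  · linear_combination
      (-(twistSign b.2 ^ (y / (n : ℤ)) * twistSign b.2 ^ ((y + 1) / (n : ℤ)))) * hx1
  · linear_combination
      (-(twistSign b.2 ^ (y / (n : ℤ)) * twistSign b.2 ^ ((y + 1) / (n : ℤ)))) * hx1
  · linear_combination
      (-(twistSign b.1 ^ (x / (m : ℤ)) * twistSign b.1 ^ ((x + 1) / (m : ℤ)))) * hy1
  · linear_combination
      (-(twistSign b.2 ^ (y / (n : ℤ)) * twistSign b.2 ^ ((y + 1) / (n : ℤ)))) * hx1
  · ring

end Fourier

/-! ### Convergence of the Fourier sums -/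

section Riemann

theorem angle_mem (k : ℕ) (b : Bool) {j : ℕ} :
    angle k b j ∈ Set.Icc (2 * Real.pi * j / k) (2 * Real.pi * (j + 1 : ℕ) / k) := by
  have hpi := Real.pi_pos
  unfold angle
  constructor
  · gcongr
    split_ifs <;> norm_num
  · push_cast
    gcongr
    split_ifs <;> norm_num

/-- A Riemann sum with one sample in each interval of length `2π / k`. -/
theorem norm_riemann_sub_integral_le {g : ℝ → ℂ} (hg : Continuous g) {k : ℕ} [NeZero k] (b : Bool)
    {ε : ℝ} (h : ∀ x ∈ Set.Icc 0 (2 * Real.pi), ∀ y ∈ Set.Icc 0 (2 * Real.pi),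
      |x - y| ≤ 2 * Real.pi / k → ‖g x - g y‖ ≤ ε) :
    ‖(1 / k : ℂ) * ∑ j ∈ Finset.range k, g (angle k b j) -
      1 / (2 * Real.pi) * ∫ x in (0 : ℝ)..(2 * Real.pi), g x‖ ≤ ε := by
  have hpi := Real.pi_pos
  have hk : (0 : ℝ) < k := Nat.cast_pos.mpr (Nat.pos_of_ne_zero (NeZero.ne k))
  have hpiC : (Real.pi : ℂ) ≠ 0 := Complex.ofReal_ne_zero.mpr hpi.ne'
  have hkC : (k : ℂ) ≠ 0 := Nat.cast_ne_zero.mpr (NeZero.ne k)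
  set a : ℕ → ℝ := fun j => 2 * Real.pi * j / k with ha
  have ha0 : a 0 = 0 := by simp [ha]
  have hak : a k = 2 * Real.pi := by simp only [ha]; field_simp
  have hlen : ∀ j, a (j + 1) - a j = 2 * Real.pi / k := by
    intro j; simp only [ha]; push_cast; field_simp; ring
  have hmono : ∀ i j, i ≤ j → a i ≤ a j := by
    intro i j hij
    have : (i : ℝ) ≤ j := by exact_mod_cast hij
    simp only [ha]
    gcongr
  have hint : ∫ x in (0 : ℝ)..(2 * Real.pi), g x =
      ∑ j ∈ Finset.range k, ∫ x in (a j)..(a (j + 1)), g x := by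
    rw [intervalIntegral.sum_integral_adjacent_intervals fun j _ => hg.intervalIntegrable _ _,
      ha0, hak]
  have hterm : ∀ j ∈ Finset.range k,
      ‖(2 * Real.pi / k : ℂ) * g (angle k b j) - ∫ x in (a j)..(a (j + 1)), g x‖ ≤
        ε * (2 * Real.pi / k) := by
    intro j hj
    have hj' : j + 1 ≤ k := Finset.mem_range.mp hj
    have hmem := angle_mem k b (j := j)
    have hsub : Set.Icc (a j) (a (j + 1)) ⊆ Set.Icc 0 (2 * Real.pi) := by
      rw [← ha0, ← hak]
      exact Set.Icc_subset_Icc (hmono _ _ (Nat.zero_le _)) (hmono _ _ hj')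
    have h1 : (2 * Real.pi / k : ℂ) * g (angle k b j) =
        ∫ _ in (a j)..(a (j + 1)), g (angle k b j) := by
      rw [intervalIntegral.integral_const, hlen, Complex.real_smul]
      push_cast
      rfl
    rw [h1, ← intervalIntegral.integral_sub (by simp) (hg.intervalIntegrable _ _)]
    have h2 := intervalIntegral.norm_integral_le_of_norm_le_const (a := a j) (b := a (j + 1))
      (f := fun x => g (angle k b j) - g x) (C := ε) ?_
    · rwa [hlen, abs_of_nonneg (by positivity)] at h2
    · intro x hx
      rw [Set.uIoc_of_le (hmono _ _ (Nat.le_succ j))] at hx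
      have hx' := Set.Ioc_subset_Icc_self hx
      refine h _ (hsub hmem) _ (hsub hx') ?_
      rw [← hlen j, abs_le]
      have h3 : a j ≤ angle k b j := hmem.1
      have h4 : angle k b j ≤ a (j + 1) := hmem.2
      constructor <;> linarith [hx'.1, hx'.2]
  have heq : (1 / k : ℂ) * ∑ j ∈ Finset.range k, g (angle k b j) -
      1 / (2 * Real.pi) * ∫ x in (0 : ℝ)..(2 * Real.pi), g x =
      1 / (2 * Real.pi) * ∑ j ∈ Finset.range k,
        ((2 * Real.pi / k : ℂ) * g (angle k b j) - ∫ x in (a j)..(a (j + 1)), g x) := by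
    rw [Finset.sum_sub_distrib, ← hint, ← Finset.mul_sum, mul_sub, ← mul_assoc]
    congr 2
    field_simp
  rw [heq, norm_mul]
  have h5 : ‖(1 / (2 * Real.pi) : ℂ)‖ = 1 / (2 * Real.pi) := by
    rw [show (1 / (2 * Real.pi) : ℂ) = ((1 / (2 * Real.pi) : ℝ) : ℂ) by push_cast; rfl,
      Complex.norm_real, Real.norm_of_nonneg (by positivity)]
  rw [h5]
  calc _ ≤ 1 / (2 * Real.pi) * ∑ j ∈ Finset.range k, ε * (2 * Real.pi / k) := by
        gcongr
        exact (norm_sum_le _ _).trans (Finset.sum_le_sum hterm)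
    _ = ε := by
        rw [Finset.sum_const, Finset.card_range, nsmul_eq_mul]
        field_simp

theorem tendsto_riemann_sum {f : ℝ → ℝ → ℂ} (hf : Continuous (Function.uncurry f))
    (b : Bool × Bool) :
    Tendsto (fun N : ℕ × ℕ => 1 / (((N.1 + 1 : ℕ) : ℂ) * ((N.2 + 1 : ℕ) : ℂ)) *
        ∑ j ∈ Finset.range (N.1 + 1), ∑ k ∈ Finset.range (N.2 + 1),
          f (angle (N.1 + 1) b.1 j) (angle (N.2 + 1) b.2 k)) atTop
      (𝓝 ((1 / (2 * (Real.pi : ℂ)) ^ 2) *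
        ∫ x in (0 : ℝ)..(2 * Real.pi), ∫ y in (0 : ℝ)..(2 * Real.pi), f x y)) := by
  have hpi := Real.pi_pos
  rw [Metric.tendsto_atTop']
  intro ε hε
  have hK : IsCompact (Set.Icc (0 : ℝ) (2 * Real.pi) ×ˢ Set.Icc (0 : ℝ) (2 * Real.pi)) :=
    isCompact_Icc.prod isCompact_Icc
  have hunif := hK.uniformContinuousOn_of_continuous hf.continuousOn
  rw [Metric.uniformContinuousOn_iff] at hunif
  obtain ⟨δ, hδ, hunif⟩ := hunif (ε / 3) (by positivity)
  obtain ⟨M, hM⟩ := exists_nat_gt (2 * Real.pi / δ)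
  have hstep : ∀ k : ℕ, M ≤ k → 2 * Real.pi / ((k + 1 : ℕ) : ℝ) < δ := by
    intro k hk
    have h1 : (M : ℝ) ≤ k := by exact_mod_cast hk
    rw [div_lt_iff₀ (by positivity)]
    rw [div_lt_iff₀ hδ] at hM
    push_cast
    nlinarith
  refine ⟨(M, M), fun N hN => ?_⟩
  have hN1 := hstep N.1 hN.le.1
  have hN2 := hstep N.2 hN.le.2
  set m := N.1 + 1
  set n := N.2 + 1
  set F : ℝ → ℂ := fun x => 1 / (2 * Real.pi) * ∫ y in (0 : ℝ)..(2 * Real.pi), f x y with hF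
  have hFc : Continuous F :=
    continuous_const.mul (intervalIntegral.continuous_parametric_intervalIntegral_of_continuous' hf
      _ _)
  have hfx : ∀ x, Continuous (f x) := fun x => hf.comp (Continuous.prodMk_right x)
  have h2pi : ‖(1 / (2 * Real.pi) : ℂ)‖ = 1 / (2 * Real.pi) := by
    rw [show (1 / (2 * Real.pi) : ℂ) = ((1 / (2 * Real.pi) : ℝ) : ℂ) by push_cast; rfl,
      Complex.norm_real, Real.norm_of_nonneg (by positivity)]
  have hclose : ∀ x ∈ Set.Icc (0 : ℝ) (2 * Real.pi), ∀ x' ∈ Set.Icc (0 : ℝ) (2 * Real.pi),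
      ∀ y ∈ Set.Icc (0 : ℝ) (2 * Real.pi), ∀ y' ∈ Set.Icc (0 : ℝ) (2 * Real.pi),
      |x - x'| < δ → |y - y'| < δ → ‖f x y - f x' y'‖ ≤ ε / 3 := by
    intro x hx x' hx' y hy y' hy' h1 h2
    have := hunif (x, y) ⟨hx, hy⟩ (x', y') ⟨hx', hy'⟩ (by
      rw [Prod.dist_eq]; exact max_lt h1 h2)
    rw [dist_eq_norm] at this
    exact this.le
  have hang : ∀ (k : ℕ) [NeZero k] (c : Bool), ∀ j ∈ Finset.range k,
      angle k c j ∈ Set.Icc (0 : ℝ) (2 * Real.pi) := by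
    intro k _ c j hj
    have hk : (0 : ℝ) < k := Nat.cast_pos.mpr (Nat.pos_of_ne_zero (NeZero.ne k))
    have h1 := angle_mem k c (j := j)
    have h2 : ((j + 1 : ℕ) : ℝ) ≤ k := by exact_mod_cast Finset.mem_range.mp hj
    refine ⟨le_trans (by positivity) h1.1, h1.2.trans ?_⟩
    rw [div_le_iff₀ hk]
    gcongr
  -- The double sum is compared with the Riemann sum of the inner integrals, and that with the
  -- double integral.
  have houter : ‖(1 / m : ℂ) * ∑ j ∈ Finset.range m, F (angle m b.1 j) -
      1 / (2 * Real.pi) * ∫ x in (0 : ℝ)..(2 * Real.pi), F x‖ ≤ ε / 3 := by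
    refine norm_riemann_sub_integral_le hFc b.1 fun x hx x' hx' hxx => ?_
    rw [hF]
    simp only
    rw [← mul_sub, ← intervalIntegral.integral_sub ((hfx x).intervalIntegrable _ _)
      ((hfx x').intervalIntegrable _ _), norm_mul, h2pi]
    have := intervalIntegral.norm_integral_le_of_norm_le_const (a := 0) (b := 2 * Real.pi)
      (f := fun y => f x y - f x' y) (C := ε / 3) (by
        intro y hy
        rw [Set.uIoc_of_le (by positivity)] at hy
        have hy' := Set.Ioc_subset_Icc_self hy
        exact hclose x hx x' hx' y hy' y hy' (hxx.trans_lt hN1) (by simpa using hδ))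
    rw [sub_zero, abs_of_pos (by positivity)] at this
    calc _ ≤ 1 / (2 * Real.pi) * (ε / 3 * (2 * Real.pi)) := by gcongr
      _ = ε / 3 := by field_simp
  have hinner : ∀ j ∈ Finset.range m, ‖(1 / n : ℂ) * ∑ k ∈ Finset.range n,
      f (angle m b.1 j) (angle n b.2 k) - F (angle m b.1 j)‖ ≤ ε / 3 := by
    intro j hj
    have hx := hang m b.1 j hj
    refine norm_riemann_sub_integral_le (hfx _) b.2 fun y hy y' hy' hyy => ?_
    exact hclose _ hx _ hx y hy y' hy' (by simpa using hδ) (hyy.trans_lt hN2)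
  have hmC : (m : ℂ) ≠ 0 := Nat.cast_ne_zero.mpr (Nat.succ_ne_zero _)
  have hm : (0 : ℝ) < m := by positivity
  have hsplit : 1 / ((m : ℂ) * (n : ℂ)) * ∑ j ∈ Finset.range m, ∑ k ∈ Finset.range n,
        f (angle m b.1 j) (angle n b.2 k) - (1 / (2 * (Real.pi : ℂ)) ^ 2) *
        ∫ x in (0 : ℝ)..(2 * Real.pi), ∫ y in (0 : ℝ)..(2 * Real.pi), f x y =
      (1 / m : ℂ) * ∑ j ∈ Finset.range m, ((1 / n : ℂ) * ∑ k ∈ Finset.range n,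
        f (angle m b.1 j) (angle n b.2 k) - F (angle m b.1 j)) +
      ((1 / m : ℂ) * ∑ j ∈ Finset.range m, F (angle m b.1 j) -
      1 / (2 * Real.pi) * ∫ x in (0 : ℝ)..(2 * Real.pi), F x) := by
    have h1 : ∫ x in (0 : ℝ)..(2 * Real.pi), F x = 1 / (2 * Real.pi) *
        ∫ x in (0 : ℝ)..(2 * Real.pi), ∫ y in (0 : ℝ)..(2 * Real.pi), f x y := by
      rw [hF, intervalIntegral.integral_const_mul]
    rw [h1, Finset.sum_sub_distrib, ← Finset.mul_sum, mul_sub]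
    have h2 : 1 / ((m : ℂ) * (n : ℂ)) = 1 / m * (1 / n) := by rw [one_div_mul_one_div]
    rw [h2]
    ring
  rw [dist_eq_norm, hsplit]
  have havg : ‖(1 / m : ℂ) * ∑ j ∈ Finset.range m, ((1 / n : ℂ) * ∑ k ∈ Finset.range n,
        f (angle m b.1 j) (angle n b.2 k) - F (angle m b.1 j))‖ ≤ ε / 3 := by
    rw [norm_mul, norm_div, norm_one, Complex.norm_natCast]
    calc _ ≤ 1 / (m : ℝ) * ∑ j ∈ Finset.range m, ε / 3 := by
          gcongr
          exact (norm_sum_le _ _).trans (Finset.sum_le_sum hinner)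
      _ = ε / 3 := by
          rw [Finset.sum_const, Finset.card_range, nsmul_eq_mul]
          field_simp
  calc _ ≤ ε / 3 + ε / 3 := (norm_add_le _ _).trans (add_le_add havg houter)
    _ < ε := by linarith

theorem inv_apply (α : ℝ) (w z : ℂ) (s t : Fin 2) : (magneticKasteleyn α w z)⁻¹ s t =
    (charPoly α w z)⁻¹ * (magneticKasteleyn α w z).adjugate s t := by
  rw [Matrix.inv_def, Ring.inverse_eq_inv', Matrix.smul_apply, smul_eq_mul, charPoly]

theorem continuousAt_magneticKasteleyn (α : ℝ) {w z : ℂ} (hw : w ≠ 0) (hz : z ≠ 0) :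
    ContinuousAt (fun p : ℂ × ℂ => magneticKasteleyn α p.1 p.2) (w, z) := by
  have h1 : ContinuousAt (fun p : ℂ × ℂ => p.1⁻¹) (w, z) := continuousAt_fst.inv₀ hw
  have h2 : ContinuousAt (fun p : ℂ × ℂ => p.2⁻¹) (w, z) := continuousAt_snd.inv₀ hz
  have h3 : ContinuousAt (fun p : ℂ × ℂ => p.1) (w, z) := continuousAt_fst
  have h4 : ContinuousAt (fun p : ℂ × ℂ => p.2) (w, z) := continuousAt_snd
  refine continuousAt_pi.mpr fun i => continuousAt_pi.mpr fun j => ?_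
  fin_cases i <;> fin_cases j <;> simp only [magneticKasteleyn] <;> simp
  · exact h4.sub h2
  · exact ((continuousAt_const.sub h4).sub h1).sub (h2.mul h1)
  · exact ((continuousAt_const.add h3).add h2).add (h4.mul h3)
  · exact h2.sub h4

theorem continuousAt_charPoly (α : ℝ) {w z : ℂ} (hw : w ≠ 0) (hz : z ≠ 0) :
    ContinuousAt (fun p : ℂ × ℂ => charPoly α p.1 p.2) (w, z) :=
  (Continuous.matrix_det continuous_id).continuousAt.comp (continuousAt_magneticKasteleyn α hw hz)

theorem continuousAt_inv_magneticKasteleyn (α : ℝ) {w z : ℂ} (hw : w ≠ 0) (hz : z ≠ 0)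
    (hP : charPoly α w z ≠ 0) (s t : Fin 2) :
    ContinuousAt (fun p : ℂ × ℂ => (magneticKasteleyn α p.1 p.2)⁻¹ s t) (w, z) := by
  simp only [inv_apply]
  refine ((continuousAt_charPoly α hw hz).inv₀ hP).mul ?_
  have h : Continuous fun M : Matrix (Fin 2) (Fin 2) ℂ => M.adjugate s t :=
    (Continuous.matrix_adjugate continuous_id).matrix_elem s t
  exact h.continuousAt.comp (continuousAt_magneticKasteleyn α hw hz)

theorem continuous_fourierIntegrand {α : ℝ} (hα : 0 ≤ α) (h3 : α ≠ 3) (u v : Vertex ℤ ℤ) :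
    Continuous (Function.uncurry (fourierIntegrand α u v)) := by
  unfold fourierIntegrand Function.uncurry
  refine Continuous.mul ?_ (by fun_prop)
  rw [continuous_iff_continuousAt]
  intro p
  have h1 : ContinuousAt (fun p : ℝ × ℝ => (Complex.exp (p.1 * Complex.I),
      Complex.exp (p.2 * Complex.I))) p := by fun_prop
  exact ContinuousAt.comp (f := fun p : ℝ × ℝ => (Complex.exp (p.1 * Complex.I),
      Complex.exp (p.2 * Complex.I)))
    (continuousAt_inv_magneticKasteleyn α (Complex.exp_ne_zero _) (Complex.exp_ne_zero _)
    (charPoly_ne_zero hα h3 (Complex.norm_exp_ofReal_mul_I _) (Complex.norm_exp_ofReal_mul_I _))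
    u.2.2 v.2.2) h1

theorem tendsto_latticeInverse {α : ℝ} (hα : 0 ≤ α) (h3 : α ≠ 3) (b : Bool × Bool)
    (u v : Vertex ℤ ℤ) :
    Tendsto (fun N : ℕ × ℕ => latticeInverse (N.1 + 1) (N.2 + 1) α b u v) atTop
      (𝓝 (inverseKasteleyn α u v)) :=
  tendsto_riemann_sum (continuous_fourierIntegrand hα h3 u v) b

end Riemann

/-! ### Exponential decay of the inverse Kasteleyn entries -/

section Decay

/-- The magnetic Kasteleyn matrix is invertible with bounded inverse on a neighbourhood of the unit
torus: this holds near each point of the torus, and the torus is compact. -/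
theorem exists_strip {α : ℝ} (hα : 0 ≤ α) (h3 : α ≠ 3) :
    ∃ δ B : ℝ, 0 < δ ∧ 0 < B ∧ ∀ w z : ℂ, w ≠ 0 → z ≠ 0 → |Real.log ‖w‖| ≤ δ →
      |Real.log ‖z‖| ≤ δ → charPoly α w z ≠ 0 ∧ ∀ s t, ‖(magneticKasteleyn α w z)⁻¹ s t‖ ≤ B := by
  set Φ : (ℝ × ℝ) × (ℝ × ℝ) → ℂ × ℂ := fun p =>
    (Complex.exp (p.1.1 + p.2.1 * Complex.I), Complex.exp (p.1.2 + p.2.2 * Complex.I)) with hΦ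
  have hΦc : Continuous Φ := by fun_prop
  set g : Fin 2 → Fin 2 → (ℝ × ℝ) × (ℝ × ℝ) → ℂ := fun s t p =>
    (magneticKasteleyn α (Φ p).1 (Φ p).2)⁻¹ s t with hg
  set K : Set (ℝ × ℝ) := Set.Icc (-Real.pi) Real.pi ×ˢ Set.Icc (-Real.pi) Real.pi
  have hK : IsCompact K := isCompact_Icc.prod isCompact_Icc
  have hne : ∀ k : ℝ × ℝ, charPoly α (Φ ((0, 0), k)).1 (Φ ((0, 0), k)).2 ≠ 0 := by
    intro k
    simp only [hΦ, Complex.ofReal_zero, zero_add]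
    exact charPoly_ne_zero hα h3 (Complex.norm_exp_ofReal_mul_I _) (Complex.norm_exp_ofReal_mul_I _)
  have hgc : ∀ s t (k : ℝ × ℝ), ContinuousAt (g s t) ((0, 0), k) := by
    intro s t k
    exact ContinuousAt.comp (g := fun p : ℂ × ℂ => (magneticKasteleyn α p.1 p.2)⁻¹ s t) (f := Φ)
      (continuousAt_inv_magneticKasteleyn α (Complex.exp_ne_zero _) (Complex.exp_ne_zero _)
        (hne k) s t) hΦc.continuousAt
  have hPc : ∀ k : ℝ × ℝ, ContinuousAt (fun p => charPoly α (Φ p).1 (Φ p).2) ((0, 0), k) := by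
    intro k
    exact ContinuousAt.comp (g := fun p : ℂ × ℂ => charPoly α p.1 p.2) (f := Φ)
      (continuousAt_charPoly α (Complex.exp_ne_zero _) (Complex.exp_ne_zero _)) hΦc.continuousAt
  have hbound : ∀ s t, ∃ C, ∀ k ∈ K, ‖g s t ((0, 0), k)‖ ≤ C := by
    intro s t
    refine hK.exists_bound_of_continuousOn ?_
    refine Continuous.continuousOn (continuous_iff_continuousAt.mpr fun k => ?_)
    exact ContinuousAt.comp (g := g s t) (f := fun k : ℝ × ℝ => (((0, 0), k) : (ℝ × ℝ) × (ℝ × ℝ)))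
      (hgc s t k) (by fun_prop)
  choose C hC using hbound
  set B : ℝ := ∑ s, ∑ t, (|C s t| + 1) with hB
  have hCB : ∀ s t, C s t < B := by
    intro s t
    have h1 : |C s t| + 1 ≤ B := by
      rw [hB]
      refine le_trans ?_ (Finset.single_le_sum (f := fun s => ∑ t, (|C s t| + 1))
        (fun i _ => by positivity) (Finset.mem_univ s))
      exact Finset.single_le_sum (f := fun t => |C s t| + 1)
        (fun i _ => by positivity) (Finset.mem_univ t)
    linarith [le_abs_self (C s t)]
  -- The first component `a` holds the logarithms of the moduli, the second the arguments; as the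
  -- arguments range over a compact set, the neighbourhood of `a = 0` is uniform.
  have hev : ∀ᶠ a in 𝓝 ((0, 0) : ℝ × ℝ), ∀ k ∈ K, charPoly α (Φ (a, k)).1 (Φ (a, k)).2 ≠ 0 ∧
      ∀ s t, ‖g s t (a, k)‖ < B := by
    refine hK.eventually_forall_of_forall_eventually (P := fun a k =>
      charPoly α (Φ (a, k)).1 (Φ (a, k)).2 ≠ 0 ∧ ∀ s t, ‖g s t (a, k)‖ < B) fun k hk => ?_
    refine ((hPc k).eventually_ne (hne k)).and ?_
    rw [eventually_all]
    intro s
    rw [eventually_all]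
    intro t
    exact (hgc s t k).norm.eventually_lt continuousAt_const ((hC s t k hk).trans_lt (hCB s t))
  rw [Metric.eventually_nhds_iff] at hev
  obtain ⟨ε, hε, hev⟩ := hev
  have hBpos : 0 < B := by
    rw [hB]
    positivity
  refine ⟨ε / 2, B, by positivity, hBpos, fun w z hw hz hw' hz' => ?_⟩
  have hrep : ∀ w : ℂ, w ≠ 0 →
      Complex.exp ((Real.log ‖w‖ : ℂ) + (Complex.arg w : ℂ) * Complex.I) = w := fun w hw =>
    Complex.exp_log hw
  have harg : ∀ w : ℂ, Complex.arg w ∈ Set.Icc (-Real.pi) Real.pi := fun w =>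
    Set.Ioc_subset_Icc_self (Complex.arg_mem_Ioc w)
  have h := hev (y := (Real.log ‖w‖, Real.log ‖z‖)) (by
    rw [Prod.dist_eq, Real.dist_eq, Real.dist_eq, sub_zero, sub_zero]
    exact max_lt (by linarith) (by linarith)) (Complex.arg w, Complex.arg z) ⟨harg w, harg z⟩
  simp only [hΦ, hg, hrep w hw, hrep z hz] at h
  exact ⟨h.1, fun s t => (h.2 s t).le⟩

/-- Cauchy's theorem on an annulus: a Fourier coefficient may be computed on the circle of radius
`r`. -/
theorem fourier_shift {H : ℂ → ℂ} {r : ℝ} (hr : 0 < r)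
    (hH : ∀ z, min 1 r ≤ ‖z‖ → ‖z‖ ≤ max 1 r → DifferentiableAt ℂ H z) (d : ℤ) :
    ∫ θ in (0 : ℝ)..(2 * Real.pi), H (Complex.exp (θ * Complex.I)) *
        Complex.exp (-Complex.I * (θ * d)) =
      ∫ θ in (0 : ℝ)..(2 * Real.pi), (r : ℂ) ^ (-d) * (H (r * Complex.exp (θ * Complex.I)) *
        Complex.exp (-Complex.I * (θ * d))) := by
  set f : ℂ → ℂ := fun z => H z * z ^ (-d) with hf
  have hfd : ∀ z, min 1 r ≤ ‖z‖ → ‖z‖ ≤ max 1 r → DifferentiableAt ℂ f z := by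
    intro z h1 h2
    have hz : z ≠ 0 := by
      rintro rfl
      rw [norm_zero] at h1
      exact absurd h1 (not_le.mpr (lt_min one_pos hr))
    exact (hH z h1 h2).mul (differentiableAt_zpow.mpr (Or.inl hz))
  have hann :=
    Complex.circleIntegral_sub_center_inv_smul_eq_of_differentiable_on_annulus_off_countable
    (c := 0) (r := min 1 r) (R := max 1 r) (lt_min one_pos hr)
    (min_le_left _ _ |>.trans (le_max_left _ _)) (f := f) Set.countable_empty
    (fun z hz => ?_) (fun z hz => ?_)
  rotate_left
  · rw [Set.mem_sdiff, mem_closedBall_zero_iff, mem_ball_zero_iff, not_lt] at hz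
    exact (hfd z hz.2 hz.1).continuousAt.continuousWithinAt
  · rw [Set.sdiff_empty, Set.mem_sdiff, mem_closedBall_zero_iff, mem_ball_zero_iff, not_le] at hz
    exact hfd z hz.2.le hz.1.le
  have hcirc : ∀ ρ : ℝ, 0 < ρ → (∮ z in C(0, ρ), (z - 0)⁻¹ • f z) =
      Complex.I * ∫ θ in (0 : ℝ)..(2 * Real.pi), f (ρ * Complex.exp (θ * Complex.I)) := by
    intro ρ hρ
    rw [circleIntegral, ← intervalIntegral.integral_const_mul]
    refine intervalIntegral.integral_congr fun θ _ => ?_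
    simp only [deriv_circleMap, sub_zero, smul_eq_mul, circleMap, zero_add]
    have h1 : (ρ : ℂ) * Complex.exp (θ * Complex.I) ≠ 0 :=
      mul_ne_zero (Complex.ofReal_ne_zero.mpr hρ.ne') (Complex.exp_ne_zero _)
    rw [mul_right_comm, ← mul_assoc, mul_inv_cancel₀ h1, one_mul, mul_comm]
  have hfin : (∫ θ in (0 : ℝ)..(2 * Real.pi), f ((1 : ℝ) * Complex.exp (θ * Complex.I))) =
      ∫ θ in (0 : ℝ)..(2 * Real.pi), f (r * Complex.exp (θ * Complex.I)) := by
    apply mul_left_cancel₀ Complex.I_ne_zero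
    rw [← hcirc 1 one_pos, ← hcirc r hr]
    rcases le_total 1 r with h | h
    · rw [min_eq_left h, max_eq_right h] at hann
      exact hann.symm
    · rw [min_eq_right h, max_eq_left h] at hann
      exact hann
  have hexp : ∀ θ : ℝ, Complex.exp (θ * Complex.I) ^ (-d) = Complex.exp (-Complex.I * (θ * d)) := by
    intro θ
    rw [← Complex.exp_int_mul]
    congr 1
    push_cast
    ring
  simp only [hf, Complex.ofReal_one, one_mul, mul_zpow, hexp] at hfin
  rw [hfin]
  refine intervalIntegral.integral_congr fun θ _ => ?_
  ring

/-- Fourier coefficients of a function bounded and analytic on an annulus decay exponentially. -/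
theorem norm_fourier_le {H : ℂ → ℂ} {δ B : ℝ} (hδ : 0 < δ)
    (hH : ∀ z : ℂ, z ≠ 0 → |Real.log ‖z‖| ≤ δ → DifferentiableAt ℂ H z ∧ ‖H z‖ ≤ B) (d : ℤ) :
    ‖∫ θ in (0 : ℝ)..(2 * Real.pi), H (Complex.exp (θ * Complex.I)) *
        Complex.exp (-Complex.I * (θ * d))‖ ≤ 2 * Real.pi * (B * Real.exp (-δ * |(d : ℝ)|)) := by
  have hpi := Real.pi_pos
  -- The radius is `exp σ`, with the sign of `σ` such that `(exp σ) ^ (-d)` is small.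
  obtain ⟨σ, hσ, hσd⟩ : ∃ σ : ℝ, |σ| = δ ∧ σ * d = δ * |(d : ℝ)| := by
    rcases le_total 0 (d : ℝ) with h | h
    · exact ⟨δ, abs_of_pos hδ, by rw [abs_of_nonneg h]⟩
    · exact ⟨-δ, by rw [abs_neg, abs_of_pos hδ], by rw [abs_of_nonpos h]; ring⟩
  have hr : 0 < Real.exp σ := Real.exp_pos σ
  have hlog : ∀ z : ℂ, min 1 (Real.exp σ) ≤ ‖z‖ → ‖z‖ ≤ max 1 (Real.exp σ) →
      z ≠ 0 ∧ |Real.log ‖z‖| ≤ δ := by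
    intro z h1 h2
    have hz : 0 < ‖z‖ := lt_of_lt_of_le (lt_min one_pos hr) h1
    refine ⟨norm_pos_iff.mp hz, ?_⟩
    rw [← hσ]
    rcases le_total 0 σ with h | h
    · rw [min_eq_left (Real.one_le_exp h)] at h1
      rw [max_eq_right (Real.one_le_exp h)] at h2
      rw [abs_of_nonneg (Real.log_nonneg h1), abs_of_nonneg h]
      exact (Real.log_le_iff_le_exp hz).mpr h2
    · rw [min_eq_right (Real.exp_le_one_iff.mpr h)] at h1
      rw [max_eq_left (Real.exp_le_one_iff.mpr h)] at h2
      rw [abs_of_nonpos (Real.log_nonpos hz.le h2), abs_of_nonpos h]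
      exact neg_le_neg ((Real.le_log_iff_exp_le hz).mpr h1)
  rw [fourier_shift hr (fun z h1 h2 => (hH z (hlog z h1 h2).1 (hlog z h1 h2).2).1) d]
  have hb := intervalIntegral.norm_integral_le_of_norm_le_const (a := 0) (b := 2 * Real.pi)
    (f := fun θ : ℝ => ((Real.exp σ : ℝ) : ℂ) ^ (-d) *
      (H ((Real.exp σ : ℝ) * Complex.exp (θ * Complex.I)) * Complex.exp (-Complex.I * (θ * d))))
    (C := B * Real.exp (-δ * |(d : ℝ)|)) ?_
  · rw [sub_zero, abs_of_pos (a := 2 * Real.pi) (by positivity)] at hb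
    linarith
  · intro θ _
    have h1 : ‖((Real.exp σ : ℝ) : ℂ) * Complex.exp (θ * Complex.I)‖ = Real.exp σ := by
      rw [norm_mul, Complex.norm_exp_ofReal_mul_I, mul_one, Complex.norm_real,
        Real.norm_of_nonneg hr.le]
    have h2 : ‖Complex.exp (-Complex.I * (θ * d))‖ = 1 := by
      rw [show -Complex.I * ((θ : ℂ) * d) = ((-(θ * d) : ℝ) : ℂ) * Complex.I by push_cast; ring,
        Complex.norm_exp_ofReal_mul_I]
    have h3 : ‖((Real.exp σ : ℝ) : ℂ) ^ (-d)‖ = Real.exp (-δ * |(d : ℝ)|) := by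
      rw [norm_zpow, Complex.norm_real, Real.norm_of_nonneg hr.le, ← Real.rpow_intCast,
        ← Real.exp_mul]
      congr 1
      push_cast
      linarith
    rw [norm_mul, norm_mul, h2, h3, mul_one, mul_comm]
    refine mul_le_mul_of_nonneg_right (hH _ ?_ ?_).2 (Real.exp_pos _).le
    · rw [← norm_pos_iff, h1]; exact hr
    · rw [h1, Real.log_exp, hσ]

theorem differentiableAt_inv_left (α : ℝ) {w z : ℂ} (hw : w ≠ 0)
    (hP : charPoly α w z ≠ 0) (s t : Fin 2) :
    DifferentiableAt ℂ (fun w => (magneticKasteleyn α w z)⁻¹ s t) w := by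
  have h1 : DifferentiableAt ℂ (fun w : ℂ => w⁻¹) w := differentiableAt_inv hw
  simp only [inv_apply]
  refine DifferentiableAt.mul (DifferentiableAt.inv ?_ hP) ?_
  · simp only [charPoly, magneticKasteleyn, Matrix.det_fin_two_of]
    fun_prop
  · simp only [magneticKasteleyn, Matrix.adjugate_fin_two_of]
    fin_cases s <;> fin_cases t <;> (try simp) <;> fun_prop

theorem differentiableAt_inv_right (α : ℝ) {w z : ℂ} (hz : z ≠ 0)
    (hP : charPoly α w z ≠ 0) (s t : Fin 2) :
    DifferentiableAt ℂ (fun z => (magneticKasteleyn α w z)⁻¹ s t) z := by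
  have h1 : DifferentiableAt ℂ (fun z : ℂ => z⁻¹) z := differentiableAt_inv hz
  simp only [inv_apply]
  refine DifferentiableAt.mul (DifferentiableAt.inv ?_ hP) ?_
  · show DifferentiableAt ℂ (fun z => charPoly α w z) z
    simp only [charPoly, magneticKasteleyn, Matrix.det_fin_two_of]
    fun_prop
  · simp only [magneticKasteleyn, Matrix.adjugate_fin_two_of]
    fin_cases s <;> fin_cases t <;> (try simp) <;> fun_prop

theorem norm_two_pi_sq_inv_mul_le {x : ℂ} {C : ℝ}
    (hx : ‖x‖ ≤ 2 * Real.pi * (2 * Real.pi * C)) :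
    ‖1 / (2 * (Real.pi : ℂ)) ^ 2 * x‖ ≤ C := by
  have hpi := Real.pi_pos
  rw [norm_mul, show (1 / (2 * (Real.pi : ℂ)) ^ 2) = ((1 / (2 * Real.pi) ^ 2 : ℝ) : ℂ) by
    push_cast; rfl, Complex.norm_real, Real.norm_of_nonneg (by positivity)]
  calc _ ≤ 1 / (2 * Real.pi) ^ 2 * (2 * Real.pi * (2 * Real.pi * C)) := by gcongr
    _ = C := by field_simp

theorem norm_integral_two_pi_le {f : ℝ → ℂ} {C : ℝ} (hf : ∀ x, ‖f x‖ ≤ C) :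
    ‖∫ x in (0 : ℝ)..(2 * Real.pi), f x‖ ≤ 2 * Real.pi * C := by
  have hpi := Real.pi_pos
  have := intervalIntegral.norm_integral_le_of_norm_le_const (a := 0) (b := 2 * Real.pi)
    (f := f) (C := C) (fun x _ => hf x)
  rw [sub_zero, abs_of_pos (by positivity)] at this
  linarith

theorem integral_fourierIntegrand_swap {α : ℝ} (hα : 0 ≤ α) (h3 : α ≠ 3) (u v : Vertex ℤ ℤ) :
    ∫ x in (0 : ℝ)..(2 * Real.pi), ∫ y in (0 : ℝ)..(2 * Real.pi), fourierIntegrand α u v x y =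
      ∫ y in (0 : ℝ)..(2 * Real.pi), ∫ x in (0 : ℝ)..(2 * Real.pi), fourierIntegrand α u v x y := by
  refine MeasureTheory.intervalIntegral_intervalIntegral_swap ?_
  exact ((continuous_fourierIntegrand hα h3 u v).continuousOn.integrableOn_compact
    (isCompact_uIcc.prod isCompact_uIcc)).mono_set
    (Set.prod_mono Set.uIoc_subset_uIcc Set.uIoc_subset_uIcc)

/-- Decay in one coordinate at a time: the other momentum stays on the unit circle. -/
theorem norm_inverseKasteleyn_le_coord {α : ℝ} (hα : 0 ≤ α) (h3 : α ≠ 3) :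
    ∃ δ B : ℝ, 0 < δ ∧ 0 < B ∧ ∀ u v : Vertex ℤ ℤ,
      ‖inverseKasteleyn α u v‖ ≤ B * Real.exp (-δ * |((v.1 - u.1 : ℤ) : ℝ)|) ∧
      ‖inverseKasteleyn α u v‖ ≤ B * Real.exp (-δ * |((v.2.1 - u.2.1 : ℤ) : ℝ)|) := by
  obtain ⟨δ, B, hδ, hB, h⟩ := exists_strip hα h3
  have hone : ∀ x : ℝ, |Real.log ‖Complex.exp (x * Complex.I)‖| ≤ δ := by
    intro x
    rw [Complex.norm_exp_ofReal_mul_I, Real.log_one, abs_zero]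
    exact hδ.le
  have hunit : ∀ (x : ℝ) (d : ℤ), ‖Complex.exp (-Complex.I * (x * d))‖ = 1 := by
    intro x d
    rw [show -Complex.I * ((x : ℂ) * d) = ((-(x * d) : ℝ) : ℂ) * Complex.I by push_cast; ring,
        Complex.norm_exp_ofReal_mul_I]
  refine ⟨δ, B, hδ, hB, fun u v => ⟨?_, ?_⟩⟩
  · have hdef : inverseKasteleyn α u v = 1 / (2 * (Real.pi : ℂ)) ^ 2 *
        ∫ x in (0 : ℝ)..(2 * Real.pi), ∫ y in (0 : ℝ)..(2 * Real.pi),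
          fourierIntegrand α u v x y := rfl
    rw [hdef, integral_fourierIntegrand_swap hα h3]
    refine norm_two_pi_sq_inv_mul_le (norm_integral_two_pi_le fun y => ?_)
    have hrw : ∀ x : ℝ, fourierIntegrand α u v x y =
        Complex.exp (-Complex.I * (y * (v.2.1 - u.2.1 : ℤ))) *
        ((magneticKasteleyn α (Complex.exp (x * Complex.I)) (Complex.exp (y * Complex.I)))⁻¹
          u.2.2 v.2.2 * Complex.exp (-Complex.I * (x * (v.1 - u.1 : ℤ)))) := by
      intro x
      rw [fourierIntegrand, mul_add, Complex.exp_add]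
      ring
    simp only [hrw]
    rw [intervalIntegral.integral_const_mul, norm_mul, hunit, one_mul]
    refine norm_fourier_le (H := fun w => (magneticKasteleyn α w (Complex.exp (y * Complex.I)))⁻¹
      u.2.2 v.2.2) hδ (fun w hw hw' => ?_) _
    have h1 := h w _ hw (Complex.exp_ne_zero _) hw' (hone y)
    exact ⟨differentiableAt_inv_left α hw h1.1 _ _, h1.2 _ _⟩
  · have hdef : inverseKasteleyn α u v = 1 / (2 * (Real.pi : ℂ)) ^ 2 *
        ∫ x in (0 : ℝ)..(2 * Real.pi), ∫ y in (0 : ℝ)..(2 * Real.pi),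
          fourierIntegrand α u v x y := rfl
    rw [hdef]
    refine norm_two_pi_sq_inv_mul_le (norm_integral_two_pi_le fun x => ?_)
    have hrw : ∀ y : ℝ, fourierIntegrand α u v x y =
        Complex.exp (-Complex.I * (x * (v.1 - u.1 : ℤ))) *
        ((magneticKasteleyn α (Complex.exp (x * Complex.I)) (Complex.exp (y * Complex.I)))⁻¹
          u.2.2 v.2.2 * Complex.exp (-Complex.I * (y * (v.2.1 - u.2.1 : ℤ)))) := by
      intro y
      rw [fourierIntegrand, mul_add, Complex.exp_add]
      ring
    simp only [hrw]
    rw [intervalIntegral.integral_const_mul, norm_mul, hunit, one_mul]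
    refine norm_fourier_le (H := fun z => (magneticKasteleyn α (Complex.exp (x * Complex.I)) z)⁻¹
      u.2.2 v.2.2) hδ (fun z hz hz' => ?_) _
    have h1 := h _ z (Complex.exp_ne_zero _) hz (hone x) hz'
    exact ⟨differentiableAt_inv_right α hz h1.1 _ _, h1.2 _ _⟩

theorem distance_le (u v : Vertex ℤ ℤ) : Vertex.distance u v ≤
    2 * |((v.1 - u.1 : ℤ) : ℝ)| + |((v.2.1 - u.2.1 : ℤ) : ℝ)| + 1 := by
  obtain ⟨x, y, t⟩ := u
  obtain ⟨x', y', t'⟩ := v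
  rw [Vertex.distance, EuclideanSpace.dist_eq, Fin.sum_univ_two]
  simp only [Vertex.pos, Real.dist_eq, sq_abs]
  push_cast
  have ht : |((t : ℕ) : ℝ) - ((t' : ℕ) : ℝ)| ≤ 1 := by
    fin_cases t <;> fin_cases t' <;> simp
  have h1 : |2 * (x : ℝ) + (t : ℕ) - (2 * x' + (t' : ℕ))| ≤ 2 * |(x' : ℝ) - x| + 1 := by
    calc _ = |2 * ((x : ℝ) - x') + (((t : ℕ) : ℝ) - ((t' : ℕ) : ℝ))| := by congr 1; ring
      _ ≤ |2 * ((x : ℝ) - x')| + |((t : ℕ) : ℝ) - ((t' : ℕ) : ℝ)| := abs_add_le _ _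
      _ ≤ _ := by
        rw [abs_mul, abs_sub_comm (x : ℝ), abs_two]
        linarith
  have h2 : |-(y : ℝ) - -y'| = |(y' : ℝ) - y| := by congr 1; ring
  refine Real.sqrt_le_iff.mpr ⟨by positivity, ?_⟩
  rw [← sq_abs, ← sq_abs (-(y : ℝ) - -y'), h2]
  have h3 := abs_nonneg ((y' : ℝ) - y)
  have h4 := abs_nonneg ((x' : ℝ) - x)
  have h5 := abs_nonneg (2 * (x : ℝ) + (t : ℕ) - (2 * x' + (t' : ℕ)))
  nlinarith

theorem norm_inverseKasteleyn_le {α : ℝ} (hα : 0 ≤ α) (h3 : α ≠ 3) :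
    ∃ C c : ℝ, 0 < C ∧ 0 < c ∧ ∀ u v : Vertex ℤ ℤ,
      ‖inverseKasteleyn α u v‖ ≤ C * Real.exp (-c * Vertex.distance u v) := by
  obtain ⟨δ, B, hδ, hB, h⟩ := norm_inverseKasteleyn_le_coord hα h3
  -- The distance is at most `3 max (X, Y) + 1`, and the larger coordinate difference is used.
  refine ⟨B * Real.exp (δ / 3), δ / 3, by positivity, by positivity, fun u v => ?_⟩
  have hd := distance_le u v
  set X := |((v.1 - u.1 : ℤ) : ℝ)|
  set Y := |((v.2.1 - u.2.1 : ℤ) : ℝ)|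
  rw [mul_assoc, ← Real.exp_add]
  rcases le_total X Y with hXY | hXY
  · refine (h u v).2.trans ?_
    gcongr
    nlinarith
  · refine (h u v).1.trans ?_
    gcongr
    nlinarith

end Decay

/-! ### Infinite-volume dimer correlations -/

section Limit

theorem Edge.sign_mul_self {A B : Type} (e : Edge A B) : Edge.sign e * Edge.sign e = 1 := by
  obtain ⟨⟨x, y, t⟩, d⟩ := e
  fin_cases t <;> cases d <;> simp [Edge.sign]

theorem abs_sign_mul_weight_le {A B : Type} {α : ℝ} (hα : 0 ≤ α) (e : Edge A B) :
    |Edge.sign e * Edge.weight α e| ≤ α + 1 := by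
  have h : |Edge.sign e| = 1 := by
    rw [← abs_one, ← sq_eq_sq_iff_abs_eq_abs, one_pow, sq, Edge.sign_mul_self]
  rw [abs_mul, h, one_mul]
  obtain ⟨⟨x, y, t⟩, d⟩ := e
  fin_cases t <;> cases d <;> simp [Edge.weight, abs_of_nonneg hα] <;> linarith

/-- The inverse twisted Kasteleyn matrix as a function on the infinite lattice, in the gauge in
which it converges. -/
def gaugedInverse (m n : ℕ) [NeZero m] [NeZero n] (α : ℝ) (b : Bool × Bool) (u v : Vertex ℤ ℤ) :
    ℝ :=
  gauge m n b u * gauge m n b v *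
    (twistedKasteleyn m n α b)⁻¹ (Vertex.proj m n u) (Vertex.proj m n v)

theorem tendsto_gaugedInverse_complex {α : ℝ} (hα : 0 ≤ α) (h3 : α ≠ 3) (b : Bool × Bool)
    (u v : Vertex ℤ ℤ) :
    Tendsto (fun N : ℕ × ℕ => (gaugedInverse (N.1 + 1) (N.2 + 1) α b u v : ℂ)) atTop
      (𝓝 (inverseKasteleyn α u v)) := by
  refine (tendsto_latticeInverse hα h3 b u v).congr fun N => ?_
  rw [latticeInverse_eq, ← inv_twistedKasteleyn _ _ hα h3, ← Complex.ofReal_mul]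
  rfl

/-- The inverse Kasteleyn entry of the infinite lattice as a real number. For `α ≠ 3` the imaginary
part vanishes, as the entry is a limit of real ones. -/
def realInverse (α : ℝ) (u v : Vertex ℤ ℤ) : ℝ := (inverseKasteleyn α u v).re

theorem tendsto_gaugedInverse {α : ℝ} (hα : 0 ≤ α) (h3 : α ≠ 3) (b : Bool × Bool)
    (u v : Vertex ℤ ℤ) :
    Tendsto (fun N : ℕ × ℕ => gaugedInverse (N.1 + 1) (N.2 + 1) α b u v) atTop
      (𝓝 (realInverse α u v)) := by
  have h := (Complex.continuous_re.tendsto _).comp (tendsto_gaugedInverse_complex hα h3 b u v)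
  exact h.congr fun N => Complex.ofReal_re _

/-- The weight of an edge with its Kasteleyn sign. -/
def signedWeight (α : ℝ) (e : Edge ℤ ℤ) : ℝ := Edge.sign e * Edge.weight α e

/-- The gauge signs cancel in local observables. -/
theorem twistedWeight_mul_inv (m n : ℕ) [NeZero m] [NeZero n] (α : ℝ) (b : Bool × Bool)
    (e : Edge ℤ ℤ) :
    twistedWeight α b (Edge.proj m n e) * (twistedKasteleyn m n α b)⁻¹
        (Edge.src (Edge.proj m n e)) (Edge.tgt (Edge.proj m n e)) =
      signedWeight α e * gaugedInverse m n α b (Edge.src e) (Edge.tgt e) := by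
  rw [twistedWeight_proj, proj_tgt, proj_src, gaugedInverse, signedWeight]
  ring

/-- Wick's expression for the joint occupation of two edges of the infinite lattice, in terms of the
inverse Kasteleyn entries `G`. -/
def wickPair (α : ℝ) (G : Vertex ℤ ℤ → Vertex ℤ ℤ → ℝ) (μ ν : Edge ℤ ℤ) : ℝ :=
  signedWeight α μ * signedWeight α ν *
    (G (Edge.src μ) (Edge.tgt μ) * G (Edge.src ν) (Edge.tgt ν) -
      G (Edge.src μ) (Edge.src ν) * G (Edge.tgt μ) (Edge.tgt ν) +
      G (Edge.src μ) (Edge.tgt ν) * G (Edge.tgt μ) (Edge.src ν))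

theorem pairTerm_proj (m n : ℕ) [NeZero m] [NeZero n] (α : ℝ) (b : Bool × Bool) (μ ν : Edge ℤ ℤ) :
    pairTerm Edge.src Edge.tgt (twistedWeight α b) (twistedKasteleyn m n α b)
        (Edge.proj m n μ) (Edge.proj m n ν) = wickPair α (gaugedInverse m n α b) μ ν := by
  simp only [pairTerm, wickPair, gaugedInverse, signedWeight, twistedWeight_proj, proj_tgt,
    proj_src]
  ring

/-- If all components converge to the same limit, so do their combinations with bounded coefficients
of sum one, whether or not the coefficients converge. -/
theorem tendsto_mixture {ι β : Type*} [Fintype ι] {l : Filter β} {p : β → ι → ℝ} {x : β → ι → ℝ}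
    {C ℓ : ℝ} (hp : ∀ᶠ N in l, (∀ b, |p N b| ≤ C) ∧ ∑ b, p N b = 1)
    (hx : ∀ b, Tendsto (fun N => x N b) l (𝓝 ℓ)) :
    Tendsto (fun N => ∑ b, p N b * x N b) l (𝓝 ℓ) := by
  have h1 : Tendsto (fun N => ∑ b, p N b * (x N b - ℓ)) l (𝓝 0) := by
    rw [← Finset.sum_const_zero (s := (Finset.univ : Finset ι))]
    refine tendsto_finsetSum _ fun b _ => ?_
    refine bdd_le_mul_tendsto_zero' C (hp.mono fun N hN => hN.1 b) ?_
    simpa using (hx b).sub_const ℓ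
  have h2 := h1.add_const ℓ
  rw [zero_add] at h2
  refine h2.congr' (hp.mono fun N hN => ?_)
  simp only [mul_sub]
  rw [Finset.sum_sub_distrib, ← Finset.sum_mul, hN.2]
  ring

theorem eventually_exists_mixture {α : ℝ} (hα : 0 ≤ α) (h3 : α ≠ 3) :
    ∃ p : ℕ × ℕ → Bool × Bool → ℝ, ∀ᶠ N : ℕ × ℕ in atTop,
      ((∀ b, |p N b| ≤ 1 / 2) ∧ ∑ b, p N b = 1) ∧
      (∀ μ, dimerMean (N.1 + 1) (N.2 + 1) α μ = ∑ b, p N b *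
        -(signedWeight α μ *
          gaugedInverse (N.1 + 1) (N.2 + 1) α b (Edge.src μ) (Edge.tgt μ))) ∧
      ∀ μ ν, Edge.proj (N.1 + 1) (N.2 + 1) μ ≠ Edge.proj (N.1 + 1) (N.2 + 1) ν →
        dimerPair (N.1 + 1) (N.2 + 1) α μ ν =
          ∑ b, p N b * wickPair α (gaugedInverse (N.1 + 1) (N.2 + 1) α b) μ ν := by
  have h : ∀ N : ℕ × ℕ, ∃ p : Bool × Bool → ℝ, 1 ≤ N.2 →
      ((∀ b, |p b| ≤ 1 / 2) ∧ ∑ b, p b = 1) ∧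
      (∀ μ, dimerMean (N.1 + 1) (N.2 + 1) α μ = ∑ b, p b *
        -(signedWeight α μ *
          gaugedInverse (N.1 + 1) (N.2 + 1) α b (Edge.src μ) (Edge.tgt μ))) ∧
      ∀ μ ν, Edge.proj (N.1 + 1) (N.2 + 1) μ ≠ Edge.proj (N.1 + 1) (N.2 + 1) ν →
        dimerPair (N.1 + 1) (N.2 + 1) α μ ν =
          ∑ b, p b * wickPair α (gaugedInverse (N.1 + 1) (N.2 + 1) α b) μ ν := by
    intro N
    -- On tori of height one the coefficients are irrelevant.
    by_cases hN : 1 ≤ N.2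
    · obtain ⟨p, hp1, hp2, hp3, hp4⟩ := exists_mixture (m := N.1 + 1) (n := N.2 + 1) hα
        (by omega) fun b => isUnit_det_twistedKasteleyn (N.1 + 1) (N.2 + 1) hα h3 b
      refine ⟨p, fun _ => ⟨⟨hp1, hp2⟩, fun μ => ?_, fun μ ν hne => ?_⟩⟩
      · rw [dimerMean, hp3]
        exact Finset.sum_congr rfl fun b _ => by rw [twistedWeight_mul_inv]
      · rw [dimerPair, hp4 _ _ hne]
        exact Finset.sum_congr rfl fun b _ => by rw [pairTerm_proj]
    · exact ⟨0, fun h => absurd h hN⟩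
  choose p hp using h
  refine ⟨p, ?_⟩
  filter_upwards [eventually_ge_atTop ((0, 1) : ℕ × ℕ)] with N hN using hp N hN.2

theorem intCast_ne_of_lt {k : ℕ} {x x' : ℤ} (hx : x ≠ x') (hk : (x' - x).natAbs < k) :
    (x : ZMod k) ≠ x' := by
  intro h
  rw [ZMod.intCast_eq_intCast_iff_dvd_sub] at h
  have h1 := Int.natAbs_dvd_natAbs.mpr h
  rw [Int.natAbs_natCast] at h1
  have h2 := Nat.eq_zero_of_dvd_of_lt h1 hk
  exact hx (by omega)

theorem eventually_proj_ne {μ ν : Edge ℤ ℤ} (h : μ ≠ ν) :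
    ∀ᶠ N : ℕ × ℕ in atTop, Edge.proj (N.1 + 1) (N.2 + 1) μ ≠ Edge.proj (N.1 + 1) (N.2 + 1) ν := by
  obtain ⟨⟨x, y, t⟩, d⟩ := μ
  obtain ⟨⟨x', y', t'⟩, d'⟩ := ν
  filter_upwards [eventually_ge_atTop ((x' - x).natAbs, (y' - y).natAbs)] with N hN heq
  simp only [Edge.proj, Vertex.proj, Prod.mk.injEq] at heq
  obtain ⟨⟨hx, hy, ht⟩, hd⟩ := heq
  have hx' : x = x' := by
    by_contra hne
    exact intCast_ne_of_lt hne (Nat.lt_succ_of_le hN.1) hx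
  have hy' : y = y' := by
    by_contra hne
    exact intCast_ne_of_lt hne (Nat.lt_succ_of_le hN.2) hy
  exact h (by rw [hx', hy', ht, hd])

/-- The dimer occupation in the infinite-volume limit. -/
def limitMean (α : ℝ) (μ : Edge ℤ ℤ) : ℝ :=
  -(signedWeight α μ * realInverse α (Edge.src μ) (Edge.tgt μ))

open Classical in
/-- The joint occupation of two edges in the infinite-volume limit. For equal edges it is the
occupation itself, for which Wick's expression would be wrong. -/
def limitPair (α : ℝ) (μ ν : Edge ℤ ℤ) : ℝ :=
  if μ = ν then limitMean α μ else wickPair α (realInverse α) μ ν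

theorem tendsto_dimerMean {α : ℝ} (hα : 0 ≤ α) (h3 : α ≠ 3) (μ : Edge ℤ ℤ) :
    Tendsto (fun N : ℕ × ℕ => dimerMean (N.1 + 1) (N.2 + 1) α μ) atTop (𝓝 (limitMean α μ)) := by
  obtain ⟨p, hp⟩ := eventually_exists_mixture hα h3
  refine (tendsto_mixture (hp.mono fun N hN => hN.1) fun b => ?_).congr'
    (hp.mono fun N hN => (hN.2.1 μ).symm)
  exact ((tendsto_gaugedInverse hα h3 b _ _).const_mul _).neg

/-- The occupation number is idempotent. -/
theorem dimerPair_self (m n : ℕ) [NeZero m] [NeZero n] (α : ℝ) (μ : Edge ℤ ℤ) :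
    dimerPair m n α μ μ = dimerMean m n α μ := by
  unfold dimerPair dimerMean
  congr 1
  ext D
  unfold occupation
  split_ifs <;> simp

theorem tendsto_dimerPair {α : ℝ} (hα : 0 ≤ α) (h3 : α ≠ 3) (μ ν : Edge ℤ ℤ) :
    Tendsto (fun N : ℕ × ℕ => dimerPair (N.1 + 1) (N.2 + 1) α μ ν) atTop
      (𝓝 (limitPair α μ ν)) := by
  by_cases hμν : μ = ν
  · subst hμν
    simp only [dimerPair_self, limitPair, if_true]
    exact tendsto_dimerMean hα h3 μ
  · rw [limitPair, if_neg hμν]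
    obtain ⟨p, hp⟩ := eventually_exists_mixture hα h3
    refine (tendsto_mixture (hp.mono fun N hN => hN.1) fun b => ?_).congr'
      (hp.mp ((eventually_proj_ne hμν).mono fun N hne hN => (hN.2.2 μ ν hne).symm))
    have h := tendsto_gaugedInverse hα h3 b
    exact ((((h _ _).mul (h _ _)).sub ((h _ _).mul (h _ _))).add
      ((h _ _).mul (h _ _))).const_mul _

theorem dist_src_tgt_le (e : Edge ℤ ℤ) :
    dist (Vertex.pos (Edge.src e)) (Vertex.pos (Edge.tgt e)) ≤ 2 := by
  obtain ⟨⟨x, y, t⟩, d⟩ := e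
  rw [EuclideanSpace.dist_eq, Fin.sum_univ_two]
  refine Real.sqrt_le_iff.mpr ⟨by norm_num, ?_⟩
  simp only [Real.dist_eq, sq_abs]
  fin_cases t <;> cases d <;> simp [Vertex.pos, Edge.src, Edge.tgt] <;> ring_nf <;> norm_num

/-- An endpoint of an edge is at distance at most one from its midpoint. -/
theorem edge_distance_le (μ ν : Edge ℤ ℤ) {u v : Vertex ℤ ℤ} (hu : u = Edge.src μ ∨ u = Edge.tgt μ)
    (hv : v = Edge.src ν ∨ v = Edge.tgt ν) : Edge.distance μ ν ≤ Vertex.distance u v + 2 := by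
  have key : ∀ (e : Edge ℤ ℤ) (u : Vertex ℤ ℤ), u = Edge.src e ∨ u = Edge.tgt e →
      dist (midpoint ℝ (Vertex.pos (Edge.src e)) (Vertex.pos (Edge.tgt e))) (Vertex.pos u) ≤ 1 := by
    intro e u hu
    have h := dist_src_tgt_le e
    rcases hu with rfl | rfl
    · rw [dist_midpoint_left, Real.norm_of_nonneg (by norm_num)]
      linarith
    · rw [dist_midpoint_right, Real.norm_of_nonneg (by norm_num)]
      linarith
  have h1 := key μ u hu
  have h2 := key ν v hv
  rw [dist_comm] at h2
  have h3 := dist_triangle4 (midpoint ℝ (Vertex.pos (Edge.src μ)) (Vertex.pos (Edge.tgt μ)))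
    (Vertex.pos u) (Vertex.pos v) (midpoint ℝ (Vertex.pos (Edge.src ν)) (Vertex.pos (Edge.tgt ν)))
  unfold Edge.distance Vertex.distance
  linarith

theorem abs_limitPair_sub_le {α : ℝ} (hα : 0 ≤ α) (h3 : α ≠ 3) :
    ∃ C c : ℝ, 0 < C ∧ 0 < c ∧ ∀ μ ν : Edge ℤ ℤ,
      |limitPair α μ ν - limitMean α μ * limitMean α ν| ≤
        C * Real.exp (-c * Edge.distance μ ν) := by
  obtain ⟨C, c, hC, hc, h⟩ := norm_inverseKasteleyn_le hα h3
  set W := α + 1 with hW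
  have hW1 : 0 < W := by linarith
  -- The factor `exp (2 c)` pays for replacing edge midpoints by endpoints.
  set A := C * Real.exp (2 * c) with hA
  have hAC : C ≤ A := le_mul_of_one_le_right hC.le (Real.one_le_exp (by positivity))
  have hG : ∀ u v, |realInverse α u v| ≤ C * Real.exp (-c * Vertex.distance u v) := fun u v =>
    (Complex.abs_re_le_norm _).trans (h u v)
  have hG1 : ∀ u v, |realInverse α u v| ≤ C := fun u v =>
    (hG u v).trans (mul_le_of_le_one_right hC.le (Real.exp_le_one_iff.mpr (by
      have : 0 ≤ Vertex.distance u v := dist_nonneg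
      nlinarith)))
  have hw : ∀ e, |signedWeight α e| ≤ W := fun e => abs_sign_mul_weight_le hα e
  have hM : ∀ μ, |limitMean α μ| ≤ W * C := by
    intro μ
    rw [limitMean, abs_neg, abs_mul]
    exact mul_le_mul (hw μ) (hG1 _ _) (abs_nonneg _) hW1.le
  refine ⟨W * C + W ^ 2 * A ^ 2 * 2, c, by positivity, hc, fun μ ν => ?_⟩
  by_cases hμν : μ = ν
  · subst hμν
    have h0 : Edge.distance μ μ = 0 := dist_self _
    rw [limitPair, if_pos rfl, h0, mul_zero, Real.exp_zero, mul_one]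
    refine (abs_sub _ _).trans ?_
    rw [abs_mul]
    have h1 := hM μ
    have h2 : |limitMean α μ| * |limitMean α μ| ≤ (W * C) * (W * C) :=
      mul_le_mul h1 h1 (abs_nonneg _) (by positivity)
    have h3 : (W * C) * (W * C) ≤ (W * A) * (W * A) := by gcongr
    nlinarith [sq_nonneg (W * A)]
  · rw [limitPair, if_neg hμν]
    set E := Real.exp (-c * Edge.distance μ ν) with hE
    have hE0 : 0 < E := Real.exp_pos _
    have hfar : ∀ u v, (u = Edge.src μ ∨ u = Edge.tgt μ) → (v = Edge.src ν ∨ v = Edge.tgt ν) →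
        |realInverse α u v| ≤ A * E := by
      intro u v hu hv
      refine (hG u v).trans ?_
      rw [hA, hE, mul_assoc, ← Real.exp_add]
      gcongr
      have := edge_distance_le μ ν hu hv
      nlinarith
    have hprod : ∀ u v u' v', (u = Edge.src μ ∨ u = Edge.tgt μ) →
        (v = Edge.src ν ∨ v = Edge.tgt ν) →
        |realInverse α u v * realInverse α u' v'| ≤ A ^ 2 * E := by
      intro u v u' v' hu hv
      rw [abs_mul]
      calc _ ≤ (A * E) * A := mul_le_mul (hfar u v hu hv) ((hG1 _ _).trans hAC) (abs_nonneg _)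
            (by positivity)
        _ = _ := by ring
    -- The product of the means cancels the first of the three terms.
    have heq : wickPair α (realInverse α) μ ν - limitMean α μ * limitMean α ν =
        signedWeight α μ * signedWeight α ν *
          (realInverse α (Edge.src μ) (Edge.tgt ν) * realInverse α (Edge.tgt μ) (Edge.src ν) -
            realInverse α (Edge.src μ) (Edge.src ν) * realInverse α (Edge.tgt μ) (Edge.tgt ν)) := by
      rw [wickPair, limitMean, limitMean]
      ring
    rw [heq, abs_mul, abs_mul]
    have h1 := hprod (Edge.src μ) (Edge.tgt ν) (Edge.tgt μ) (Edge.src ν) (Or.inl rfl) (Or.inr rfl)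
    have h2 := hprod (Edge.src μ) (Edge.src ν) (Edge.tgt μ) (Edge.tgt ν) (Or.inl rfl) (Or.inl rfl)
    calc _ ≤ W * W * (A ^ 2 * E + A ^ 2 * E) :=
          mul_le_mul (mul_le_mul (hw μ) (hw ν) (abs_nonneg _) hW1.le)
            ((abs_sub _ _).trans (add_le_add h1 h2)) (abs_nonneg _) (by positivity)
      _ ≤ _ := by
        have : 0 ≤ W * C * E := by positivity
        linarith

end Limit

end TriDimer

end

theorem mainTheorem2 (α : ℝ) (hα : 0 ≤ α) :
    (∀ kx ky : ℝ,
      TriDimer.charPoly α (Complex.exp (kx * Complex.I)) (Complex.exp (ky * Complex.I)) = 0 ↔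
        α = 3 ∧ (∃ a : ℤ, kx = 2 * Real.pi * a) ∧ ∃ b : ℤ, ky = 2 * Real.pi * b) ∧
    (α ≠ 3 →
      (∀ (m n : ℕ) [NeZero m] [NeZero n], IsUnit (TriDimer.kasteleyn m n α).det) ∧
      (∀ u v : TriDimer.Vertex ℤ ℤ,
        Tendsto
          (fun N : ℕ × ℕ =>
            (((TriDimer.kasteleyn (N.1 + 1) (N.2 + 1) α)⁻¹
              (TriDimer.Vertex.proj (N.1 + 1) (N.2 + 1) u)
              (TriDimer.Vertex.proj (N.1 + 1) (N.2 + 1) v) : ℝ) : ℂ))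
          atTop (𝓝 (TriDimer.inverseKasteleyn α u v))) ∧
      (∃ C c : ℝ, 0 < C ∧ 0 < c ∧ ∀ u v : TriDimer.Vertex ℤ ℤ,
        ‖TriDimer.inverseKasteleyn α u v‖ ≤
          C * Real.exp (-c * TriDimer.Vertex.distance u v)) ∧
      ∃ (d₁ : TriDimer.Edge ℤ ℤ → ℝ) (d₂ : TriDimer.Edge ℤ ℤ → TriDimer.Edge ℤ ℤ → ℝ),
        (∀ μ, Tendsto (fun N : ℕ × ℕ => TriDimer.dimerMean (N.1 + 1) (N.2 + 1) α μ)
          atTop (𝓝 (d₁ μ))) ∧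
        (∀ μ ν, Tendsto (fun N : ℕ × ℕ => TriDimer.dimerPair (N.1 + 1) (N.2 + 1) α μ ν)
          atTop (𝓝 (d₂ μ ν))) ∧
        ∃ C c : ℝ, 0 < C ∧ 0 < c ∧ ∀ μ ν : TriDimer.Edge ℤ ℤ,
          |d₂ μ ν - d₁ μ * d₁ ν| ≤ C * Real.exp (-c * TriDimer.Edge.distance μ ν)) := by
  refine ⟨TriDimer.charPoly_exp_eq_zero_iff hα, fun h3 => ⟨fun m n _ _ => ?_, fun u v => ?_,
    TriDimer.norm_inverseKasteleyn_le hα h3, TriDimer.limitMean α, TriDimer.limitPair α,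
    TriDimer.tendsto_dimerMean hα h3, TriDimer.tendsto_dimerPair hα h3,
    TriDimer.abs_limitPair_sub_le hα h3⟩⟩
  · rw [← TriDimer.twistedKasteleyn_false]
    exact TriDimer.isUnit_det_twistedKasteleyn m n hα h3 _
  · refine (TriDimer.tendsto_gaugedInverse_complex hα h3 (false, false) u v).congr fun N => ?_
    rw [TriDimer.gaugedInverse, TriDimer.gauge_false, TriDimer.gauge_false,
      TriDimer.twistedKasteleyn_false, one_mul, one_mul]
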